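/- Let $\alpha,\beta\in(1,2)$, $a_1<b_1$, $a_2<b_2$, $T>0$, and consider the two-dimensional space-fractional diffusion equation $$\partial_t u=d_+\frac{\partial^\alpha u}{\partial_+x^\alpha}+d_-\frac{\partial^\alpha u}{\partial_-x^\alpha}+e_+\frac{\partial^\beta u}{\partial_+y^\beta}+e_-\frac{\partial^\beta u}{\partial_-y^\beta}+v\quad\text{on }(a_1,b_1)\times(a_2,b_2)\times(0,T]$$ with zero boundary values and constant, equal diffusion coefficients $d_\pm\equiv d>0$, $e_\pm\equiv e>0$. For $\gamma\in(1,2)$ put $g_k^{(\gamma)}=(-1)^k\binom{\gamma}{k}$, $w_0^{(\gamma)}=\frac{\gamma}{2}g_0^{(\gamma)}$, $w_k^{(\gamma)}=\frac{\gamma}{2}g_k^{(\gamma)}+\frac{2-\gamma}{2}g_{k-1}^{(\gamma)}$ for $k\ge 1$, $w_k^{(\gamma)}=0$ for $k<0$, and $A^\gamma_n=[-w^{(\gamma)}_{i-j+1}]_{i,j=1}^n$. For positive integers $n_1,n_2,M$ put $N=n_1n_2$, $h_x=\frac{b_1-a_1}{n_1+1}$, $h_y=\frac{b_2-a_2}{n_2+1}$,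 $\Delta t=\frac TM$, $r=\frac{\Delta t}{2h_x^\alpha}$, $s=\frac{\Delta t}{2h_y^\beta}$. The coefficient matrix of the Crank–Nicolson weighted and shifted Grünwald scheme at time step $m\in\{1,\dots,M\}$, multiplied by $1/r$, is $$\mathcal M_N^{(m)}=\tfrac1r I_N+A_x^{(m)}+\tfrac sr A_y^{(m)},$$ $$A_x^{(m)}=D_+(I_{n_2}\otimes A^\alpha_{n_1})+D_-(I_{n_2}\otimes (A^\alpha_{n_1})^T),\qquad A_y^{(m)}=E_+(A^\beta_{n_2}\otimes I_{n_1})+E_-((A^\beta_{n_2})^T\otimes I_{n_1}),$$ where $D_\pm,E_\pm$ are the diagonal matrices of the samples of $d_\pm,e_\pm$ at the interior grid points $(a_1+ih_x,a_2+jh_y)$ and at time $m\Delta t$. Consider any sequence of discretizations $(n_1,n_2,M,m)$ with $N=n_1n_2\to\infty$, $\frac1r=o(1)$ and $\frac sr=\frac{h_x^\alpha}{h_y^\beta}=O(1)$. Let $$f_\gamma(\xi)=-\sum_{k=-1}^\infty w^{(\gamma)}_{k+1}e^{\mathrm ik\xi},\qquad q_\gamma(\xi)=f_\gamma(\xi)+f_\gamma(-\xi),$$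 $$\mathcal F_{(\alpha,\beta)}(\theta_1,\theta_2)=d\,q_\alpha(\theta_1)+e\,\tfrac sr\,q_\beta(\theta_2).$$ Then: 1. The series defining $f_\alpha$ and $f_\beta$ converge absolutely, and $f_\gamma(-\xi)=\overline{f_\gamma(\xi)}$ for $\gamma\in\{\alpha,\beta\}$ and $\xi\in\mathbb R$. 2. $\mathcal F_{(\alpha,\beta)}$ is real-valued, continuous and nonnegative; the same holds with $s/r$ replaced by any constant $c\ge0$. 3. $\{\mathcal M_N^{(m)}\}$ is distributed as $(\mathcal F_{(\alpha,\beta)},[-\pi,\pi]^2)$ in the sense of the eigenvalues: for every continuous compactly supported $F:\mathbb C\to\mathbb C$, with the eigenvalues $\lambda_j$ counted with multiplicity, $$\frac1N\sum_{j=1}^N F\big(\lambda_j(\mathcal M_N^{(m)})\big)-\frac1{4\pi^2}\int_{[-\pi,\pi]^2}F\big(\mathcal F_{(\alpha,\beta)}(\theta)\big)\,d\theta\longrightarrow0,$$ where $\mathcal F_{(\alpha,\beta)}$ contains the ratio $s/r$ of the respective discretization. If moreover $s/r\to c$ along the sequence, then $$\frac1N\sum_{j=1}^N F\big(\lambda_j(\mathcal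 M_N^{(m)})\big)\longrightarrow\frac1{4\pi^2}\int_{[-\pi,\pi]^2}F\big(d\,q_\alpha(\theta_1)+e\,c\,q_\beta(\theta_2)\big)\,d\theta.$$ -/

import Mathlib

open Filter Topology MeasureTheory Set Asymptotics
open scoped Kronecker

noncomputable section

/-- The data of the two-dimensional space-fractional diffusion problem
`u_t = d₊ ∂^α u/∂₊x^α + d₋ ∂^α u/∂₋x^α + e₊ ∂^β u/∂₊y^β + e₋ ∂^β u/∂₋y^β + v`
on `(a₁,b₁) × (a₂,b₂) × (0,T]` which enter the coefficient matrices of its discretization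
(the forcing term and the initial datum only enter the right-hand sides). -/
structure FDEData where
  /-- order of the fractional derivatives in `x` -/
  α : ℝ
  /-- order of the fractional derivatives in `y` -/
  β : ℝ
  a₁ : ℝ
  b₁ : ℝ
  a₂ : ℝ
  b₂ : ℝ
  /-- final time -/
  T : ℝ
  dPlus : ℝ → ℝ → ℝ → ℝ
  dMinus : ℝ → ℝ → ℝ → ℝ
  ePlus : ℝ → ℝ → ℝ → ℝ
  eMinus : ℝ → ℝ → ℝ → ℝ
  hα : α ∈ Ioo (1 : ℝ) 2
  hβ : β ∈ Ioo (1 : ℝ) 2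
  hab₁ : a₁ < b₁
  hab₂ : a₂ < b₂
  hT : 0 < T
  /-- the diffusion coefficients are nonnegative -/
  hnonneg : ∀ x ∈ Ioo a₁ b₁, ∀ y ∈ Ioo a₂ b₂, ∀ t ∈ Ioc 0 T,
    0 ≤ dPlus x y t ∧ 0 ≤ dMinus x y t ∧ 0 ≤ ePlus x y t ∧ 0 ≤ eMinus x y t

/-- Alternating fractional binomial coefficients
`g_k = (-1)^k γ (γ - 1) ⋯ (γ - k + 1) / k!`. -/
def gCoeff (γ : ℝ) (k : ℕ) : ℝ :=
  (-1) ^ k / (k.factorial : ℝ) * ∏ i ∈ Finset.range k, (γ - (i : ℝ))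

/-- Weights of the weighted and shifted Grünwald difference formula with shifts `(1, 0)`. -/
def wCoeff (γ : ℝ) : ℕ → ℝ
  | 0 => γ / 2 * gCoeff γ 0
  | k + 1 => γ / 2 * gCoeff γ (k + 1) + (2 - γ) / 2 * gCoeff γ k

/-- The lower Hessenberg Toeplitz matrix `[-w_{i-j+1}]`, where `w_k = 0` for `k < 0`. -/
def toepA (γ : ℝ) (n : ℕ) : Matrix (Fin n) (Fin n) ℝ :=
  Matrix.of fun i j =>
    if (j : ℕ) ≤ (i : ℕ) + 1 then -wCoeff γ ((i : ℕ) + 1 - (j : ℕ)) else 0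

namespace FDEData

/-- Mesh size in `x` with `n₁` interior nodes. -/
def hx (P : FDEData) (n₁ : ℕ) : ℝ := (P.b₁ - P.a₁) / ((n₁ : ℝ) + 1)

/-- Mesh size in `y` with `n₂` interior nodes. -/
def hy (P : FDEData) (n₂ : ℕ) : ℝ := (P.b₂ - P.a₂) / ((n₂ : ℝ) + 1)

/-- Time step with `M` steps. -/
def dt (P : FDEData) (M : ℕ) : ℝ := P.T / (M : ℝ)

/-- `r = Δt / (2 h_x^α)`. -/
def r (P : FDEData) (n₁ M : ℕ) : ℝ := P.dt M / (2 * P.hx n₁ ^ P.α)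

/-- `s = Δt / (2 h_y^β)`. -/
def s (P : FDEData) (n₂ M : ℕ) : ℝ := P.dt M / (2 * P.hy n₂ ^ P.β)

/-- The diagonal matrix of the samples `c(x_i, y_j, t^{(m)})` of a coefficient `c` at the interior
nodes. The unknowns are ordered with the `x`-index running fastest, so the index is `(j, i)`;
`Fin` starts at `0`, hence the shift by one. -/
def diagSample (P : FDEData) (c : ℝ → ℝ → ℝ → ℝ) (n₁ n₂ M m : ℕ) :
    Matrix (Fin n₂ × Fin n₁) (Fin n₂ × Fin n₁) ℝ :=
  Matrix.diagonal fun p =>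
    c (P.a₁ + (((p.2 : ℕ) : ℝ) + 1) * P.hx n₁)
      (P.a₂ + (((p.1 : ℕ) : ℝ) + 1) * P.hy n₂)
      ((m : ℝ) * P.dt M)

/-- `A_x^{(m)} = D₊ (I ⊗ A^α) + D₋ (I ⊗ (A^α)ᵀ)`. -/
def matAx (P : FDEData) (n₁ n₂ M m : ℕ) :
    Matrix (Fin n₂ × Fin n₁) (Fin n₂ × Fin n₁) ℝ :=
  P.diagSample P.dPlus n₁ n₂ M m * ((1 : Matrix (Fin n₂) (Fin n₂) ℝ) ⊗ₖ toepA P.α n₁)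
    + P.diagSample P.dMinus n₁ n₂ M m
        * ((1 : Matrix (Fin n₂) (Fin n₂) ℝ) ⊗ₖ (toepA P.α n₁).transpose)

/-- `A_y^{(m)} = E₊ (A^β ⊗ I) + E₋ ((A^β)ᵀ ⊗ I)`. -/
def matAy (P : FDEData) (n₁ n₂ M m : ℕ) :
    Matrix (Fin n₂ × Fin n₁) (Fin n₂ × Fin n₁) ℝ :=
  P.diagSample P.ePlus n₁ n₂ M m * (toepA P.β n₂ ⊗ₖ (1 : Matrix (Fin n₁) (Fin n₁) ℝ))
    + P.diagSample P.eMinus n₁ n₂ M m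
        * ((toepA P.β n₂).transpose ⊗ₖ (1 : Matrix (Fin n₁) (Fin n₁) ℝ))

/-- The scaled coefficient matrix `(1/r) I + A_x^{(m)} + (s/r) A_y^{(m)}` of the linear system
solved at the `m`-th time step of the Crank–Nicolson scheme. -/
def coeffMatrix (P : FDEData) (n₁ n₂ M m : ℕ) :
    Matrix (Fin n₂ × Fin n₁) (Fin n₂ × Fin n₁) ℝ :=
  (1 / P.r n₁ M) • (1 : Matrix (Fin n₂ × Fin n₁) (Fin n₂ × Fin n₁) ℝ)
    + P.matAx n₁ n₂ M m + (P.s n₂ M / P.r n₁ M) • P.matAy n₁ n₂ M m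

end FDEData

/-- `f_γ(ξ) = -∑_{k ≥ -1} w_{k+1} e^{i k ξ}` (the summation index is shifted by one). -/
def fSymbol (γ ξ : ℝ) : ℂ :=
  -∑' k : ℕ, (wCoeff γ k : ℂ) * Complex.exp (Complex.I * ((k : ℂ) - 1) * (ξ : ℂ))

/-- `q_γ(ξ) = f_γ(ξ) + f_γ(-ξ)`. -/
def qSymbol (γ ξ : ℝ) : ℂ := fSymbol γ ξ + fSymbol γ (-ξ)

/-- `d q_α(θ₁) + e c q_β(θ₂)`; in the application `c` is the ratio `s / r`. -/
def symbolF (α β d e c : ℝ) (θ : ℝ × ℝ) : ℂ :=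
  (d : ℂ) * qSymbol α θ.1 + (e : ℂ) * (c : ℂ) * qSymbol β θ.2

/-- `(1/N) ∑_j F(λ_j(A))`, the eigenvalues being counted with algebraic multiplicity. -/
def eigMean {n : Type} [Fintype n] [DecidableEq n] (A : Matrix n n ℂ) (F : ℂ → ℂ) : ℂ :=
  (A.charpoly.roots.map F).sum / (Fintype.card n : ℂ)

/-- `(1/|G|) ∫_G F(f(t)) dt`. -/
def symbolMean {X : Type} [MeasureSpace X] (f : X → ℂ) (G : Set X) (F : ℂ → ℂ) : ℂ :=
  (((volume : Measure X).real G : ℝ) : ℂ)⁻¹ * ∫ t in G, F (f t)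

/-- The sequence of matrices `A k` is distributed as `(f, G)` in the sense of the eigenvalues. -/
def EigDistributed {n : ℕ → Type} [∀ k, Fintype (n k)] [∀ k, DecidableEq (n k)]
    (A : ∀ k, Matrix (n k) (n k) ℂ) {X : Type} [MeasureSpace X] (f : X → ℂ) (G : Set X) : Prop :=
  ∀ F : ℂ → ℂ, Continuous F → HasCompactSupport F →
    Tendsto (fun k => eigMean (A k) F) atTop (𝓝 (symbolMean f G F))

/-- The same for a symbol `f k` which varies along the sequence: for every test function the two
means are asymptotically equal. For `f k = f` this is `EigDistributed A f G`. -/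
def EigDistributedVarying {n : ℕ → Type} [∀ k, Fintype (n k)] [∀ k, DecidableEq (n k)]
    (A : ∀ k, Matrix (n k) (n k) ℂ) {X : Type} [MeasureSpace X] (f : ℕ → X → ℂ) (G : Set X) :
    Prop :=
  ∀ F : ℂ → ℂ, Continuous F → HasCompactSupport F →
    Tendsto (fun k => eigMean (A k) F - symbolMean (f k) G F) atTop (𝓝 0)

end

/-! For constant equal coefficients the matrix is a Kronecker sum `d • (I ⊗ (t I + T(a))) + x •
(T(b) ⊗ I)`, with `t = 1/(r d)`, `x = e s/r` and symmetric Toeplitz matrices `T(a)`, `T(b)` whose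
entries are the Fourier coefficients of `q_α`, `q_β`. Its eigenvalues are real and eventually lie in
one compact interval, so by Weierstrass approximation it suffices to compare moments: normalized
traces of powers against means of powers of the symbol (`eigDistributedVarying_of_moments`).

The two Kronecker summands commute and the trace of a Kronecker product factors, so the binomial
formula reduces every moment to one-dimensional ones; Fubini expands the symbol mean in the same
way. In one dimension, `T(a) T(b)` differs from `T(a * b)` by a matrix whose entries have total
absolute value `o(n)` (`entrySum_toeplitz_mul_sub`, `tendsto_boundaryMass_div`). Hence the
normalized trace of `T(a)^p` tends to the zeroth coefficient of the `p`-fold convolution power,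
which is the mean of the `p`-th power of the symbol.

The delicate point is that `n₂` may stay bounded. From `1/r → 0` and `M ≥ 1` one gets `h_x^α → 0`,
hence `n₁ → ∞`. Along bounded `n₂` the ratio `s/r = h_x^α / h_y^β` then tends to zero and suppresses
the error in the `y` direction (`tendsto_mul_comp_of_eq_mul`).

Nonnegativity of the symbol is a sign pattern: the Fourier coefficients of `q_γ` away from zero are
nonpositive and their total sum is nonnegative, so `q_γ(ξ) ≥ q_γ(0) ≥ 0`. -/

/-! ### Trigonometric series with absolutely summable coefficients -/

/-- The trigonometric series `∑_{k ∈ ℤ} a_k e^{i k ξ}`. -/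
noncomputable def trigSum (a : ℤ → ℝ) (ξ : ℝ) : ℂ :=
  ∑' k : ℤ, (a k : ℂ) * Complex.exp (Complex.I * (k : ℂ) * (ξ : ℂ))

theorem norm_exp_I_mul_int_mul (k : ℤ) (ξ : ℝ) :
    ‖Complex.exp (Complex.I * (k : ℂ) * (ξ : ℂ))‖ = 1 := by
  have h : Complex.I * (k : ℂ) * (ξ : ℂ) = (((k : ℝ) * ξ : ℝ) : ℂ) * Complex.I := by
    push_cast; ring
  rw [h, Complex.norm_exp_ofReal_mul_I]

theorem norm_trigSum_term (a : ℤ → ℝ) (k : ℤ) (ξ : ℝ) :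
    ‖(a k : ℂ) * Complex.exp (Complex.I * (k : ℂ) * (ξ : ℂ))‖ = |a k| := by
  rw [norm_mul, norm_exp_I_mul_int_mul, mul_one, Complex.norm_real, Real.norm_eq_abs]

theorem summable_norm_trigSum_term {a : ℤ → ℝ} (ha : Summable fun k => |a k|) (ξ : ℝ) :
    Summable fun k : ℤ => ‖(a k : ℂ) * Complex.exp (Complex.I * (k : ℂ) * (ξ : ℂ))‖ := by
  simpa only [norm_trigSum_term] using ha

theorem norm_trigSum_le {a : ℤ → ℝ} (ha : Summable fun k => |a k|) (ξ : ℝ) :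
    ‖trigSum a ξ‖ ≤ ∑' k, |a k| := by
  refine (norm_tsum_le_tsum_norm (summable_norm_trigSum_term ha ξ)).trans (le_of_eq ?_)
  simp only [norm_trigSum_term]

theorem continuous_trigSum {a : ℤ → ℝ} (ha : Summable fun k => |a k|) :
    Continuous (trigSum a) := by
  refine continuous_tsum (fun k => by fun_prop) ha fun k ξ => ?_
  rw [norm_trigSum_term]

theorem re_trigSum {a : ℤ → ℝ} (ha : Summable fun k => |a k|) (ξ : ℝ) :
    HasSum (fun k : ℤ => a k * Real.cos (k * ξ)) (trigSum a ξ).re := by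
  have h := (summable_norm_trigSum_term ha ξ).of_norm.hasSum
  refine (Complex.hasSum_re h).congr_fun fun k => ?_
  have e : Complex.I * (k : ℂ) * (ξ : ℂ) = (((k : ℝ) * ξ : ℝ) : ℂ) * Complex.I := by
    push_cast; ring
  rw [e, Complex.re_ofReal_mul, Complex.exp_ofReal_mul_I_re]

/-! ### The weights of the difference formula -/

theorem gCoeff_zero (γ : ℝ) : gCoeff γ 0 = 1 := by simp [gCoeff]

/-- This recurrence carries all sign information: the factor `k - γ` is positive from `k = 2` on. -/
theorem gCoeff_succ (γ : ℝ) (k : ℕ) :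
    ((k : ℝ) + 1) * gCoeff γ (k + 1) = ((k : ℝ) - γ) * gCoeff γ k := by
  have h : ((k.factorial : ℕ) : ℝ) ≠ 0 := by positivity
  have h' : (k : ℝ) + 1 ≠ 0 := by positivity
  simp only [gCoeff, Finset.prod_range_succ, Nat.factorial_succ, pow_succ]
  push_cast
  field_simp
  ring

theorem gCoeff_one (γ : ℝ) : gCoeff γ 1 = -γ := by simp [gCoeff]

theorem gCoeff_two (γ : ℝ) : gCoeff γ 2 = γ * (γ - 1) / 2 := by
  have := gCoeff_succ γ 1
  rw [gCoeff_one] at this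
  push_cast at this
  norm_num at this
  linarith

theorem gCoeff_nonneg {γ : ℝ} (hγ : γ ∈ Ioo (1 : ℝ) 2) (k : ℕ) : 0 ≤ gCoeff γ (k + 2) := by
  obtain ⟨h1, h2⟩ := hγ
  induction k with
  | zero => rw [gCoeff_two]; have : 0 < γ - 1 := by linarith
            positivity
  | succ k ih =>
    have h := gCoeff_succ γ (k + 2)
    push_cast at h
    have h3 : 0 ≤ ((k : ℝ) + 2 + 1) * gCoeff γ (k + 2 + 1) := by
      rw [h]
      refine mul_nonneg ?_ ih
      have : (0 : ℝ) ≤ k := k.cast_nonneg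
      linarith
    exact nonneg_of_mul_nonneg_right h3 (by positivity)

/-- Partial alternating sums of binomial coefficients of order `γ` are the alternating coefficients
of order `γ - 1`; multiplying by `γ` expresses these through order `γ` again. -/
theorem sum_gCoeff (γ : ℝ) (n : ℕ) :
    γ * ∑ k ∈ Finset.range (n + 1), gCoeff γ k = (γ - n) * gCoeff γ n := by
  induction n with
  | zero => simp [gCoeff_zero]
  | succ n ih =>
    rw [Finset.sum_range_succ, mul_add, ih]
    have := gCoeff_succ γ n
    push_cast
    linarith

theorem sum_gCoeff_nonpos {γ : ℝ} (hγ : γ ∈ Ioo (1 : ℝ) 2) (n : ℕ) :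
    ∑ k ∈ Finset.range (n + 2 + 1), gCoeff γ k ≤ 0 := by
  have h := sum_gCoeff γ (n + 2)
  have h1 : γ * ∑ k ∈ Finset.range (n + 2 + 1), gCoeff γ k ≤ 0 := by
    rw [h]
    refine mul_nonpos_of_nonpos_of_nonneg ?_ (gCoeff_nonneg hγ n)
    push_cast
    have : (0 : ℝ) ≤ n := n.cast_nonneg
    linarith [hγ.2]
  have h2 : 0 < γ := by linarith [hγ.1]
  by_contra hc
  push Not at hc
  exact absurd h1 (not_le.2 (mul_pos h2 hc))

theorem summable_gCoeff {γ : ℝ} (hγ : γ ∈ Ioo (1 : ℝ) 2) : Summable (gCoeff γ) := by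
  rw [← summable_nat_add_iff 2]
  -- The bound is `-(g_0 + g_1) = γ - 1`: the terms from index 2 on are nonnegative, and the full
  -- partial sums are nonpositive.
  refine summable_of_sum_range_le (c := γ - 1) (gCoeff_nonneg hγ) fun n => ?_
  have h := sum_gCoeff_nonpos hγ n
  rw [Finset.sum_range_succ, Finset.sum_range_succ', Finset.sum_range_succ', gCoeff_zero,
    gCoeff_one] at h
  have := gCoeff_nonneg hγ n
  simp only [add_assoc] at h ⊢
  norm_num at h ⊢
  linarith

/-- The sum is in fact zero, but only its sign matters for the symbol. -/
theorem tsum_gCoeff_nonpos {γ : ℝ} (hγ : γ ∈ Ioo (1 : ℝ) 2) : ∑' k, gCoeff γ k ≤ 0 := by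
  have h := ((summable_gCoeff hγ).hasSum.tendsto_sum_nat).comp (tendsto_add_atTop_nat 3)
  exact le_of_tendsto' h fun n => sum_gCoeff_nonpos hγ n

/-- The weights average `g` and its shift with factors `γ/2` and `(2-γ)/2`, which add up to one; the
total is therefore unchanged. -/
theorem hasSum_wCoeff {γ : ℝ} (hγ : γ ∈ Ioo (1 : ℝ) 2) :
    HasSum (wCoeff γ) (∑' k, gCoeff γ k) := by
  have h := summable_gCoeff hγ
  have h1 : HasSum (fun k => gCoeff γ (k + 1)) (∑' k, gCoeff γ k - gCoeff γ 0) := by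
    have h0 := (hasSum_nat_add_iff' 1).2 h.hasSum
    rwa [Finset.sum_range_one] at h0
  have h2 := (h1.mul_left (γ / 2)).add (h.hasSum.mul_left ((2 - γ) / 2))
  have h3 : HasSum (fun k => wCoeff γ (k + 1)) (∑' k, gCoeff γ k - wCoeff γ 0) := by
    have e : ∑' k, gCoeff γ k - wCoeff γ 0
        = γ / 2 * (∑' k, gCoeff γ k - gCoeff γ 0) + (2 - γ) / 2 * ∑' k, gCoeff γ k := by
      rw [wCoeff]
      ring
    rw [e]
    exact h2
  have h4 := (hasSum_nat_add_iff 1).1 h3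
  simpa using h4

theorem wCoeff_nonneg {γ : ℝ} (hγ : γ ∈ Ioo (1 : ℝ) 2) (k : ℕ) : 0 ≤ wCoeff γ (k + 3) := by
  have h1 := gCoeff_nonneg hγ (k + 1)
  have h2 := gCoeff_nonneg hγ k
  obtain ⟨h3, h4⟩ := hγ
  change 0 ≤ γ / 2 * gCoeff γ (k + 1 + 2) + (2 - γ) / 2 * gCoeff γ (k + 2)
  have : 0 ≤ 2 - γ := by linarith
  positivity

/-- On its own `w_2` can be negative for `γ` close to 1. In `q_γ` it occurs only together with
`w_0`, and `w_0 + w_2 = γ(γ-1)(γ+2)/4`. -/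
theorem wCoeff_zero_add_two_nonneg {γ : ℝ} (hγ : γ ∈ Ioo (1 : ℝ) 2) :
    0 ≤ wCoeff γ 0 + wCoeff γ 2 := by
  obtain ⟨h3, h4⟩ := hγ
  have h5 : wCoeff γ 0 + wCoeff γ 2
      = γ / 2 * gCoeff γ 0 + (γ / 2 * gCoeff γ 2 + (2 - γ) / 2 * gCoeff γ 1) := rfl
  rw [h5, gCoeff_zero, gCoeff_one, gCoeff_two]
  nlinarith [mul_pos (sub_pos.2 h3) (by linarith : 0 < γ),
    mul_pos (mul_pos (sub_pos.2 h3) (by linarith : 0 < γ)) (by linarith : 0 < γ)]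

/-- The weights, extended by zero to negative indices. -/
noncomputable def extWeight (γ : ℝ) (k : ℤ) : ℝ := if 0 ≤ k then wCoeff γ k.toNat else 0

/-- The Fourier coefficients of `q_γ`. -/
noncomputable def symCoeff (γ : ℝ) (k : ℤ) : ℝ := -(extWeight γ (k + 1) + extWeight γ (1 - k))

theorem extWeight_natCast (γ : ℝ) (k : ℕ) : extWeight γ (k : ℤ) = wCoeff γ k := by
  simp [extWeight]

theorem extWeight_of_neg (γ : ℝ) {k : ℤ} (hk : k < 0) : extWeight γ k = 0 := by
  simp [extWeight, hk]

theorem summable_abs_wCoeff {γ : ℝ} (hγ : γ ∈ Ioo (1 : ℝ) 2) :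
    Summable fun k => |wCoeff γ k| := (hasSum_wCoeff hγ).summable.abs

theorem hasSum_extWeight {γ : ℝ} (hγ : γ ∈ Ioo (1 : ℝ) 2) :
    HasSum (extWeight γ) (∑' k, gCoeff γ k) := by
  rw [← Nat.cast_injective.hasSum_iff (g := ((↑) : ℕ → ℤ))]
  · rw [show extWeight γ ∘ ((↑) : ℕ → ℤ) = wCoeff γ from funext (extWeight_natCast γ)]
    exact hasSum_wCoeff hγ
  · intro k hk
    refine extWeight_of_neg γ (lt_of_not_ge fun h => hk ⟨k.toNat, by simp [h]⟩)

theorem hasSum_extWeight_add_one {γ : ℝ} (hγ : γ ∈ Ioo (1 : ℝ) 2) :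
    HasSum (fun k => extWeight γ (k + 1)) (∑' k, gCoeff γ k) := by
  have h := hasSum_extWeight hγ
  rw [← (Equiv.addRight (1 : ℤ)).hasSum_iff] at h
  exact h

theorem hasSum_extWeight_one_sub {γ : ℝ} (hγ : γ ∈ Ioo (1 : ℝ) 2) :
    HasSum (fun k => extWeight γ (1 - k)) (∑' k, gCoeff γ k) := by
  have h := hasSum_extWeight hγ
  rw [← (Equiv.subLeft (1 : ℤ)).hasSum_iff] at h
  exact h

theorem hasSum_symCoeff {γ : ℝ} (hγ : γ ∈ Ioo (1 : ℝ) 2) :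
    HasSum (symCoeff γ) (-(∑' k, gCoeff γ k + ∑' k, gCoeff γ k)) :=
  ((hasSum_extWeight_add_one hγ).add (hasSum_extWeight_one_sub hγ)).neg

theorem summable_symCoeff {γ : ℝ} (hγ : γ ∈ Ioo (1 : ℝ) 2) :
    Summable fun k => |symCoeff γ k| := (hasSum_symCoeff hγ).summable.abs

theorem symCoeff_neg (γ : ℝ) (k : ℤ) : symCoeff γ (-k) = symCoeff γ k := by
  simp only [symCoeff, sub_neg_eq_add]
  rw [add_comm, add_comm 1 k, neg_add_eq_sub]

/-- By evenness only positive indices matter. At index 1 the weights `w_0` and `w_2` overlap; from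
index 2 on only a single weight of index at least 3 remains. -/
theorem symCoeff_nonpos {γ : ℝ} (hγ : γ ∈ Ioo (1 : ℝ) 2) {k : ℤ} (hk : k ≠ 0) :
    symCoeff γ k ≤ 0 := by
  have pos : ∀ n : ℕ, symCoeff γ ((n : ℤ) + 1) ≤ 0 := by
    intro n
    rcases n with _ | n
    · have h := wCoeff_zero_add_two_nonneg hγ
      have h0 := extWeight_natCast γ 0
      have h2 := extWeight_natCast γ 2
      simp only [symCoeff]
      norm_num at h0 h2 ⊢
      rw [h0, h2]
      linarith
    · have h := wCoeff_nonneg hγ n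
      have h0 := extWeight_natCast γ (n + 3)
      simp only [symCoeff]
      rw [extWeight_of_neg γ (by push_cast; omega : (1 : ℤ) - (((n + 1 : ℕ) : ℤ) + 1) < 0)]
      rw [show ((n + 1 : ℕ) : ℤ) + 1 + 1 = ((n + 3 : ℕ) : ℤ) by push_cast; ring, h0]
      linarith
  rcases lt_or_gt_of_ne hk with h | h
  · rw [← symCoeff_neg]
    have := pos (-k - 1).toNat
    rwa [Int.toNat_of_nonneg (by omega), sub_add_cancel] at this
  · have := pos (k - 1).toNat
    rwa [Int.toNat_of_nonneg (by omega), sub_add_cancel] at this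

theorem fSymbol_eq_neg_trigSum (γ ξ : ℝ) :
    fSymbol γ ξ = -trigSum (fun k => extWeight γ (k + 1)) ξ := by
  rw [fSymbol, trigSum]
  congr 1
  have inj : Function.Injective fun k : ℕ => (k : ℤ) - 1 := fun a b h => by simpa using h
  rw [← inj.tsum_eq]
  · refine tsum_congr fun k => ?_
    rw [sub_add_cancel, extWeight_natCast]
    push_cast
    rfl
  · intro k hk
    by_contra hc
    apply hk
    have h : k + 1 < 0 := lt_of_not_ge fun h => hc ⟨(k + 1).toNat, by
      simp only [Int.toNat_of_nonneg h, add_sub_cancel_right]⟩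
    simp only [extWeight_of_neg γ h, Complex.ofReal_zero, zero_mul]

/-- Replacing `ξ` by `-ξ` reflects the coefficient index, so the two series merge into one with even
coefficients. -/
theorem qSymbol_eq_trigSum {γ : ℝ} (hγ : γ ∈ Ioo (1 : ℝ) 2) (ξ : ℝ) :
    qSymbol γ ξ = trigSum (symCoeff γ) ξ := by
  rw [qSymbol, fSymbol_eq_neg_trigSum, fSymbol_eq_neg_trigSum]
  have h1 := (hasSum_extWeight_add_one hγ).summable.abs
  have h2 := (hasSum_extWeight_one_sub hγ).summable.abs
  have e : trigSum (fun k => extWeight γ (k + 1)) (-ξ)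
      = trigSum (fun k => extWeight γ (1 - k)) ξ := by
    rw [trigSum, trigSum, ← (Equiv.neg ℤ).tsum_eq]
    refine tsum_congr fun k => ?_
    simp only [Equiv.neg_apply]
    rw [neg_add_eq_sub]
    push_cast
    congr 2
    ring
  rw [e, ← neg_add]
  simp only [trigSum]
  rw [← Summable.tsum_add (summable_norm_trigSum_term h1 ξ).of_norm
    (summable_norm_trigSum_term h2 ξ).of_norm, ← tsum_neg]
  refine tsum_congr fun k => ?_
  simp only [symCoeff]
  push_cast
  ring

theorem fSymbol_neg (γ ξ : ℝ) : fSymbol γ (-ξ) = (starRingEnd ℂ) (fSymbol γ ξ) := by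
  rw [fSymbol, fSymbol, map_neg, Complex.conj_tsum]
  congr 1
  refine tsum_congr fun k => ?_
  rw [map_mul, Complex.conj_ofReal, ← Complex.exp_conj]
  simp

theorem qSymbol_im (γ ξ : ℝ) : (qSymbol γ ξ).im = 0 := by
  rw [qSymbol, fSymbol_neg]
  simp

/-- Since `a_k ≤ 0` for `k ≠ 0`, each `a_k cos(kξ)` is at least `a_k`; the symbol is thus bounded
below by its value at zero. -/
theorem qSymbol_re_nonneg {γ : ℝ} (hγ : γ ∈ Ioo (1 : ℝ) 2) (ξ : ℝ) : 0 ≤ (qSymbol γ ξ).re := by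
  rw [qSymbol_eq_trigSum hγ]
  have h1 : 0 ≤ -(∑' k, gCoeff γ k + ∑' k, gCoeff γ k) := by
    linarith [tsum_gCoeff_nonpos hγ]
  refine h1.trans (hasSum_le (fun k => ?_) (hasSum_symCoeff hγ)
    (re_trigSum (summable_symCoeff hγ) ξ))
  rcases eq_or_ne k 0 with rfl | hk
  · simp
  · nlinarith [symCoeff_nonpos hγ hk, Real.cos_le_one (k * ξ)]

theorem continuous_qSymbol {γ : ℝ} (hγ : γ ∈ Ioo (1 : ℝ) 2) : Continuous (qSymbol γ) := by
  rw [funext (qSymbol_eq_trigSum hγ)]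
  exact continuous_trigSum (summable_symCoeff hγ)

/-! ### Toeplitz matrices -/

/-- The Toeplitz matrix `[a_{i-j}]`. -/
def toeplitz (a : ℤ → ℝ) (n : ℕ) : Matrix (Fin n) (Fin n) ℝ :=
  Matrix.of fun i j => a ((i : ℤ) - (j : ℤ))

theorem toepA_add_transpose (γ : ℝ) (n : ℕ) :
    toepA γ n + (toepA γ n).transpose = toeplitz (symCoeff γ) n := by
  have key : ∀ i j : ℕ, (if j ≤ i + 1 then -wCoeff γ (i + 1 - j) else 0)
      = -extWeight γ ((i : ℤ) - j + 1) := by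
    intro i j
    split_ifs with h
    · rw [show (i : ℤ) - j + 1 = ((i + 1 - j : ℕ) : ℤ) by omega, extWeight_natCast]
    · rw [extWeight_of_neg γ (by omega), neg_zero]
  ext i j
  simp only [Matrix.add_apply, Matrix.transpose_apply, toepA, toeplitz, Matrix.of_apply, symCoeff,
    key]
  rw [show (j : ℤ) - i + 1 = 1 - ((i : ℤ) - j) by ring]
  ring

/-! ### Convolution of absolutely summable sequences -/

/-- Convolution of two sequences indexed by `ℤ`. -/
noncomputable def conv (a b : ℤ → ℝ) (k : ℤ) : ℝ := ∑' m, a (k - m) * b m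

/-- Convolution powers of a sequence indexed by `ℤ`. -/
noncomputable def convPow (a : ℤ → ℝ) : ℕ → ℤ → ℝ
  | 0 => Pi.single 0 1
  | p + 1 => conv (convPow a p) a

/-- The shear `(k, m) ↦ (k - m, m)` of `ℤ × ℤ`. -/
def shearEquiv : ℤ × ℤ ≃ ℤ × ℤ where
  toFun p := (p.1 - p.2, p.2)
  invFun p := (p.1 + p.2, p.2)
  left_inv p := by simp
  right_inv p := by simp

theorem summable_abs_conv_terms {a b : ℤ → ℝ} (ha : Summable fun k => |a k|)
    (hb : Summable fun k => |b k|) : Summable fun p : ℤ × ℤ => |a (p.1 - p.2) * b p.2| := by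
  have h := Summable.mul_norm (f := a) (g := b) ha hb
  rw [← shearEquiv.summable_iff] at h
  exact h

theorem summable_abs_conv {a b : ℤ → ℝ} (ha : Summable fun k => |a k|)
    (hb : Summable fun k => |b k|) : Summable fun k => |conv a b k| := by
  have h := summable_abs_conv_terms ha hb
  refine Summable.of_nonneg_of_le (fun k => abs_nonneg _) (fun k => ?_)
    (f := fun k => ∑' m, |a (k - m) * b m|) h.prod
  exact norm_tsum_le_tsum_norm (f := fun m => a (k - m) * b m) (h.prod_factor k)

theorem summable_abs_single : Summable fun k : ℤ => |(Pi.single 0 1 : ℤ → ℝ) k| := by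
  refine summable_of_ne_finset_zero (s := {0}) fun k hk => ?_
  rw [Pi.single_eq_of_ne (by simpa using hk), abs_zero]

theorem summable_abs_convPow {a : ℤ → ℝ} (ha : Summable fun k => |a k|) (p : ℕ) :
    Summable fun k => |convPow a p k| := by
  induction p with
  | zero => exact summable_abs_single
  | succ p ih => exact summable_abs_conv ih ha

/-- Absolute convergence allows multiplying the series as a double sum, which the shear then
regroups by the total frequency. -/
theorem trigSum_conv {a b : ℤ → ℝ} (ha : Summable fun k => |a k|)
    (hb : Summable fun k => |b k|) (ξ : ℝ) :
    trigSum (conv a b) ξ = trigSum a ξ * trigSum b ξ := by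
  rw [trigSum, trigSum, trigSum, tsum_mul_tsum_of_summable_norm
    (summable_norm_trigSum_term ha ξ) (summable_norm_trigSum_term hb ξ), ← shearEquiv.tsum_eq]
  have hs := Summable.mul_norm (summable_norm_trigSum_term ha ξ) (summable_norm_trigSum_term hb ξ)
  rw [← shearEquiv.summable_iff] at hs
  have hs' := hs.of_norm
  rw [Summable.tsum_prod (by exact hs')]
  refine tsum_congr fun k => ?_
  rw [conv, Complex.ofReal_tsum, ← tsum_mul_right]
  refine tsum_congr fun m => ?_
  have e : Complex.exp (Complex.I * (k : ℂ) * (ξ : ℂ))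
      = Complex.exp (Complex.I * ((k - m : ℤ) : ℂ) * (ξ : ℂ))
        * Complex.exp (Complex.I * (m : ℂ) * (ξ : ℂ)) := by
    rw [← Complex.exp_add]
    push_cast
    congr 1
    ring
  rw [e]
  simp only [shearEquiv, Equiv.coe_fn_mk]
  push_cast
  ring

theorem trigSum_single (ξ : ℝ) : trigSum (Pi.single 0 1) ξ = 1 := by
  rw [trigSum, tsum_eq_single 0]
  · simp
  · intro k hk
    rw [Pi.single_eq_of_ne hk]
    simp

theorem trigSum_convPow {a : ℤ → ℝ} (ha : Summable fun k => |a k|) (p : ℕ) (ξ : ℝ) :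
    trigSum (convPow a p) ξ = trigSum a ξ ^ p := by
  induction p with
  | zero => rw [pow_zero]; exact trigSum_single ξ
  | succ p ih => rw [pow_succ, ← ih]; exact trigSum_conv (summable_abs_convPow ha p) ha ξ

/-- The mean of a function over `[-π, π]`. -/
noncomputable def circleMean (f : ℝ → ℂ) : ℂ :=
  ((2 * Real.pi : ℝ) : ℂ)⁻¹ * ∫ ξ in Icc (-Real.pi) Real.pi, f ξ

theorem setIntegral_exp_I_mul_int_mul (k : ℤ) :
    ∫ ξ in Icc (-Real.pi) Real.pi, Complex.exp (Complex.I * (k : ℂ) * (ξ : ℂ))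
      = if k = 0 then ((2 * Real.pi : ℝ) : ℂ) else 0 := by
  rw [integral_Icc_eq_integral_Ioc,
    ← intervalIntegral.integral_of_le (by linarith [Real.pi_pos])]
  split_ifs with h
  · subst h
    simp only [Int.cast_zero, mul_zero, zero_mul, Complex.exp_zero,
      intervalIntegral.integral_const, sub_neg_eq_add]
    rw [← two_mul, Complex.real_smul, mul_one]
  · have hk : Complex.I * (k : ℂ) ≠ 0 := by simp [h]
    rw [integral_exp_mul_complex hk, div_eq_zero_iff]
    left
    rw [sub_eq_zero, Complex.exp_eq_exp_iff_exists_int]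
    -- The exponents at `π` and `-π` differ by `2πik`.
    exact ⟨k, by push_cast; ring⟩

theorem circleMean_trigSum {a : ℤ → ℝ} (ha : Summable fun k => |a k|) :
    circleMean (trigSum a) = a 0 := by
  have h := hasSum_integral_of_summable_integral_norm
    (μ := (volume : Measure ℝ).restrict (Icc (-Real.pi) Real.pi))
    (F := fun (k : ℤ) (ξ : ℝ) => (a k : ℂ) * Complex.exp (Complex.I * (k : ℂ) * (ξ : ℂ)))
    (fun k => (by fun_prop : Continuous _).integrableOn_Icc) (by
      simp only [norm_trigSum_term]
      simpa using ha.mul_left _)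
  simp only [integral_const_mul, setIntegral_exp_I_mul_int_mul] at h
  have h2 := h.tsum_eq
  rw [tsum_eq_single 0 (fun k hk => by simp [hk])] at h2
  rw [circleMean]
  change _ * (∫ ξ in Icc (-Real.pi) Real.pi, ∑' k : ℤ, _) = _
  rw [← h2, if_pos rfl]
  have hpi : ((2 * Real.pi : ℝ) : ℂ) ≠ 0 := by
    exact_mod_cast (by positivity : (2 * Real.pi : ℝ) ≠ 0)
  field_simp

/-- This turns moments of the symbol into diagonal entries of Toeplitz matrices, the form in which
traces produce them. -/
theorem circleMean_trigSum_pow {a : ℤ → ℝ} (ha : Summable fun k => |a k|) (p : ℕ) :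
    circleMean (fun ξ => trigSum a ξ ^ p) = convPow a p 0 := by
  rw [← circleMean_trigSum (summable_abs_convPow ha p)]
  congr 1
  funext ξ
  exact (trigSum_convPow ha p ξ).symm

/-! ### Entrywise sums of matrices -/

/-- The sum of the absolute values of the entries of a matrix. -/
def entrySum {ι : Type*} [Fintype ι] (E : Matrix ι ι ℝ) : ℝ := ∑ i, ∑ j, |E i j|

section EntrySum

variable {ι : Type*} [Fintype ι]

theorem entrySum_nonneg (E : Matrix ι ι ℝ) : 0 ≤ entrySum E :=
  Finset.sum_nonneg fun _ _ => Finset.sum_nonneg fun _ _ => abs_nonneg _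

theorem entrySum_add_le (E F : Matrix ι ι ℝ) : entrySum (E + F) ≤ entrySum E + entrySum F := by
  simp only [entrySum, ← Finset.sum_add_distrib]
  exact Finset.sum_le_sum fun i _ => Finset.sum_le_sum fun j _ => abs_add_le _ _

theorem sum_abs_mul_le_of_row_le {K : ℝ} (E T : Matrix ι ι ℝ) (hT : ∀ l, ∑ j, |T l j| ≤ K)
    (i : ι) : ∑ j, |(E * T) i j| ≤ (∑ l, |E i l|) * K := by
  calc ∑ j, |(E * T) i j| ≤ ∑ j, ∑ l, |E i l| * |T l j| := by
        refine Finset.sum_le_sum fun j _ => ?_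
        rw [Matrix.mul_apply]
        refine (Finset.abs_sum_le_sum_abs _ _).trans (le_of_eq ?_)
        simp only [abs_mul]
    _ = ∑ l, |E i l| * ∑ j, |T l j| := by
        rw [Finset.sum_comm]
        simp only [Finset.mul_sum]
    _ ≤ (∑ l, |E i l|) * K := by
        rw [Finset.sum_mul]
        exact Finset.sum_le_sum fun l _ => mul_le_mul_of_nonneg_left (hT l) (abs_nonneg _)

/-- The entrywise sum dominates the trace, and multiplication by a matrix with bounded row or column
sums enlarges it by a bounded factor only. An `o(n)` error thus survives products. -/
theorem entrySum_mul_le_of_row_le {K : ℝ} (E T : Matrix ι ι ℝ) (hT : ∀ l, ∑ j, |T l j| ≤ K) :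
    entrySum (E * T) ≤ entrySum E * K := by
  rw [entrySum, entrySum, Finset.sum_mul]
  exact Finset.sum_le_sum fun i _ => sum_abs_mul_le_of_row_le E T hT i

theorem entrySum_transpose (E : Matrix ι ι ℝ) : entrySum E.transpose = entrySum E := by
  rw [entrySum, entrySum, Finset.sum_comm]
  rfl

theorem entrySum_mul_le_of_col_le {K : ℝ} (T E : Matrix ι ι ℝ) (hT : ∀ l, ∑ i, |T i l| ≤ K) :
    entrySum (T * E) ≤ K * entrySum E := by
  rw [← entrySum_transpose (T * E), Matrix.transpose_mul, ← entrySum_transpose E, mul_comm]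
  exact entrySum_mul_le_of_row_le _ _ hT

theorem abs_trace_le_entrySum (E : Matrix ι ι ℝ) : |E.trace| ≤ entrySum E := by
  refine (Finset.abs_sum_le_sum_abs _ _).trans (Finset.sum_le_sum fun i _ => ?_)
  exact Finset.single_le_sum (f := fun j => |E i j|) (fun j _ => abs_nonneg _) (Finset.mem_univ i)

end EntrySum

/-! ### Products of Toeplitz matrices -/

theorem sum_abs_comp_le {a : ℤ → ℝ} (ha : Summable fun k => |a k|) {n : ℕ} (f : Fin n → ℤ)
    (hf : Function.Injective f) : ∑ i, |a (f i)| ≤ ∑' k, |a k| := by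
  have h := ha.sum_le_tsum (Finset.univ.map ⟨f, hf⟩) (fun k _ => abs_nonneg _)
  rwa [Finset.sum_map] at h

theorem toeplitz_row_le {a : ℤ → ℝ} (ha : Summable fun k => |a k|) {n : ℕ} (i : Fin n) :
    ∑ j, |toeplitz a n i j| ≤ ∑' k, |a k| :=
  sum_abs_comp_le ha (fun j : Fin n => (i : ℤ) - (j : ℤ)) fun j j' h => by
    have : (j : ℤ) = (j' : ℤ) := by simpa using h
    exact Fin.ext (by exact_mod_cast this)

theorem toeplitz_col_le {a : ℤ → ℝ} (ha : Summable fun k => |a k|) {n : ℕ} (j : Fin n) :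
    ∑ i, |toeplitz a n i j| ≤ ∑' k, |a k| :=
  sum_abs_comp_le ha (fun i : Fin n => (i : ℤ) - (j : ℤ)) fun j j' h => by
    have : (j : ℤ) = (j' : ℤ) := by simpa using h
    exact Fin.ext (by exact_mod_cast this)

open Classical in
/-- The number of `j < n` with `m + j ∉ [0, n)`. -/
noncomputable def exitCount (n : ℕ) (m : ℤ) : ℕ :=
  ((Finset.range n).filter fun j : ℕ => m + (j : ℤ) ∉ Ico (0 : ℤ) n).card

open Classical in
theorem exitCount_le (n : ℕ) (m : ℤ) : exitCount n m ≤ n :=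
  (Finset.card_filter_le _ _).trans (by simp)

-- A shift by `m` pushes out at most `|m|` indices: at the top end for `m ≥ 0`, at the bottom end
-- for `m ≤ 0`.
open Classical in
theorem exitCount_le_natAbs (n : ℕ) (m : ℤ) : exitCount n m ≤ m.natAbs := by
  rcases le_total 0 m with h | h
  · have : (Finset.range n).filter (fun j : ℕ => m + (j : ℤ) ∉ Ico (0 : ℤ) n)
        ⊆ Finset.Ico (n - m.natAbs) n := by
      intro j hj
      simp only [Finset.mem_filter, Finset.mem_range, Set.mem_Ico, Finset.mem_Ico] at hj ⊢
      omega
    refine (Finset.card_le_card this).trans ?_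
    rw [Nat.card_Ico]
    omega
  · have : (Finset.range n).filter (fun j : ℕ => m + (j : ℤ) ∉ Ico (0 : ℤ) n)
        ⊆ Finset.range m.natAbs := by
      intro j hj
      simp only [Finset.mem_filter, Finset.mem_range, Set.mem_Ico] at hj ⊢
      omega
    exact (Finset.card_le_card this).trans (by simp)

/-- The total mass of `b` connecting indices in `[0, n)` to indices outside. -/
noncomputable def boundaryMass (b : ℤ → ℝ) (n : ℕ) : ℝ := ∑' m, |b m| * exitCount n m

/-- Dominated convergence: `exitCount n m ≤ |m|` makes each term vanish after division by `n`, and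
`exitCount n m ≤ n` gives the majorant `|b m|`. No decay of `b` beyond summability is needed. -/
theorem tendsto_boundaryMass_div {b : ℤ → ℝ} (hb : Summable fun k => |b k|) :
    Tendsto (fun n : ℕ => boundaryMass b n / n) atTop (𝓝 0) := by
  have h := tendsto_tsum_of_dominated_convergence (𝓕 := atTop)
    (f := fun (n : ℕ) (m : ℤ) => |b m| * ((exitCount n m : ℝ) / n)) (g := fun _ => 0) hb
    (fun m => ?_) (Eventually.of_forall fun n m => ?_)
  · simpa only [tsum_zero, boundaryMass, ← mul_div_assoc, tsum_div_const] using h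
  · have h1 : Tendsto (fun n : ℕ => |b m| * ((m.natAbs : ℝ) / n)) atTop (𝓝 0) := by
      simpa using (tendsto_const_div_atTop_nhds_zero_nat (m.natAbs : ℝ)).const_mul |b m|
    refine squeeze_zero (fun n => by positivity) (fun n => ?_) h1
    have := exitCount_le_natAbs n m
    gcongr
  · rw [Real.norm_of_nonneg (by positivity)]
    refine mul_le_of_le_one_right (abs_nonneg _) (div_le_one_of_le₀ ?_ (Nat.cast_nonneg n))
    exact_mod_cast exitCount_le n m

open Classical in
theorem sum_tsum_outside (b : ℤ → ℝ) (hb : Summable fun k => |b k|) (n : ℕ) :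
    ∑ j : Fin n, ∑' l : ℤ, (if l ∈ Ico (0 : ℤ) n then 0 else |b (l - j)|) = boundaryMass b n := by
  have h1 : ∀ j : ℕ, ∑' l : ℤ, (if l ∈ Ico (0 : ℤ) n then 0 else |b (l - j)|)
      = ∑' m : ℤ, (if m + j ∈ Ico (0 : ℤ) n then 0 else |b m|) := by
    intro j
    rw [← (Equiv.addRight (j : ℤ)).tsum_eq]
    simp
  have h2 : ∀ j : ℕ, Summable fun m : ℤ => (if m + j ∈ Ico (0 : ℤ) n then 0 else |b m|) := by
    intro j
    refine Summable.of_nonneg_of_le (fun m => ?_) (fun m => ?_) hb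
    · split_ifs <;> positivity
    · split_ifs
      · positivity
      · exact le_rfl
  rw [Fin.sum_univ_eq_sum_range
    (fun j : ℕ => ∑' l : ℤ, (if l ∈ Ico (0 : ℤ) n then 0 else |b (l - j)|)) n]
  simp only [h1]
  rw [← Summable.tsum_finsetSum fun j _ => h2 j, boundaryMass]
  refine tsum_congr fun m => ?_
  rw [exitCount, Finset.card_filter]
  push_cast
  rw [Finset.mul_sum]
  refine Finset.sum_congr rfl fun j _ => ?_
  split_ifs <;> simp

theorem summable_conv_terms_shift {a b : ℤ → ℝ} (ha : Summable fun k => |a k|)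
    (hb : Summable fun k => |b k|) (i j : ℤ) :
    Summable fun l => |a (i - l) * b (l - j)| := by
  have h := (summable_abs_conv_terms ha hb).prod_factor (i - j)
  rw [← (Equiv.subRight j).summable_iff] at h
  refine h.congr fun l => ?_
  simp

theorem conv_sub (a b : ℤ → ℝ) (i j : ℤ) : conv a b (i - j) = ∑' l, a (i - l) * b (l - j) := by
  rw [conv, ← (Equiv.subRight j).tsum_eq]
  simp

/-- The matrix product misses exactly those terms `a_{i-l} b_{l-j}` of the convolution with `l`
outside `[0, n)`. Summing over `i` first leaves the `ℓ¹` norm of `a`; the remaining sum is the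
boundary mass of `b`. -/
theorem entrySum_toeplitz_mul_sub {a b : ℤ → ℝ} (ha : Summable fun k => |a k|)
    (hb : Summable fun k => |b k|) (n : ℕ) :
    entrySum (toeplitz a n * toeplitz b n - toeplitz (conv a b) n)
      ≤ (∑' k, |a k|) * boundaryMass b n := by
  have key : ∀ i j : Fin n, |(toeplitz a n * toeplitz b n - toeplitz (conv a b) n) i j|
      ≤ ∑' l : ℤ, (if l ∈ Ico (0 : ℤ) n then 0 else |a (i - l)| * |b (l - j)|) := by
    intro i j
    have hs := (summable_conv_terms_shift ha hb i j)
    have hin : ∑ l : Fin n, a ((i : ℤ) - l) * b (l - j)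
        = ∑' l : ℤ, (if l ∈ Ico (0 : ℤ) n then a (i - l) * b (l - j) else 0) := by
      rw [Fin.sum_univ_eq_sum_range (fun l : ℕ => a ((i : ℤ) - l) * b (l - j)) n,
        tsum_eq_sum (s := (Finset.range n).map Nat.castEmbedding)]
      · rw [Finset.sum_map]
        refine Finset.sum_congr rfl fun l hl => ?_
        have hl' := Finset.mem_range.1 hl
        rw [if_pos]
        · rfl
        · simp [hl']
      · intro l hl
        rw [if_neg]
        rintro ⟨h0, h1⟩
        apply hl
        rw [Finset.mem_map]
        exact ⟨l.toNat, Finset.mem_range.2 (by omega), Int.toNat_of_nonneg h0⟩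
    have hs1 : Summable fun l : ℤ =>
        (if l ∈ Ico (0 : ℤ) n then a (i - l) * b (l - j) else 0) :=
      summable_of_hasFiniteSupport ((Set.finite_Ico (0 : ℤ) n).subset fun l hl => by
        by_contra hc
        exact hl (if_neg hc))
    have hdiff : (toeplitz a n * toeplitz b n - toeplitz (conv a b) n) i j
        = ∑' l : ℤ, (if l ∈ Ico (0 : ℤ) n then 0 else -(a (i - l) * b (l - j))) := by
      simp only [Matrix.sub_apply, Matrix.mul_apply, toeplitz, Matrix.of_apply]
      rw [conv_sub, hin, ← Summable.tsum_sub hs1 hs.of_abs]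
      refine tsum_congr fun l => ?_
      split_ifs <;> ring
    rw [hdiff]
    have hs2 : Summable fun l : ℤ =>
        ‖(if l ∈ Ico (0 : ℤ) n then 0 else -(a (i - l) * b (l - j)))‖ := by
      refine Summable.of_nonneg_of_le (fun l => norm_nonneg _) (fun l => ?_) hs
      split_ifs
      · simp [-abs_mul]
      · simp
    refine (norm_tsum_le_tsum_norm hs2).trans (le_of_eq (tsum_congr fun l => ?_))
    split_ifs <;> simp
  have hsum : ∀ i j : Fin n, Summable fun l : ℤ =>
      (if l ∈ Ico (0 : ℤ) n then 0 else |a (i - l)| * |b (l - j)|) := by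
    intro i j
    refine Summable.of_nonneg_of_le (fun l => ?_) (fun l => ?_)
      (summable_conv_terms_shift ha hb i j)
    · split_ifs <;> positivity
    · split_ifs
      · positivity
      · rw [abs_mul]
  have hsumb : ∀ j : Fin n, Summable fun l : ℤ =>
      (if l ∈ Ico (0 : ℤ) n then 0 else |b (l - j)|) := by
    intro j
    refine Summable.of_nonneg_of_le (fun l => ?_) (fun l => ?_)
      ((Equiv.subRight (j : ℤ)).summable_iff.2 hb)
    · split_ifs <;> positivity
    · split_ifs
      · exact abs_nonneg _
      · exact le_rfl
  calc entrySum (toeplitz a n * toeplitz b n - toeplitz (conv a b) n)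
      ≤ ∑ i : Fin n, ∑ j : Fin n,
          ∑' l : ℤ, (if l ∈ Ico (0 : ℤ) n then 0 else |a (i - l)| * |b (l - j)|) :=
        Finset.sum_le_sum fun i _ => Finset.sum_le_sum fun j _ => key i j
    _ = ∑ j : Fin n, ∑' l : ℤ, ∑ i : Fin n,
          (if l ∈ Ico (0 : ℤ) n then 0 else |a (i - l)| * |b (l - j)|) := by
        rw [Finset.sum_comm]
        refine Finset.sum_congr rfl fun j _ => ?_
        rw [Summable.tsum_finsetSum fun i _ => hsum i j]
    _ ≤ ∑ j : Fin n, ∑' l : ℤ,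
          (∑' k, |a k|) * (if l ∈ Ico (0 : ℤ) n then 0 else |b (l - j)|) := by
        refine Finset.sum_le_sum fun j _ => Summable.tsum_le_tsum (fun l => ?_)
          (summable_sum fun i _ => hsum i j) ((hsumb j).mul_left _)
        split_ifs
        · simp
        · rw [← Finset.sum_mul]
          refine mul_le_mul_of_nonneg_right ?_ (abs_nonneg _)
          exact sum_abs_comp_le ha (fun i : Fin n => (i : ℤ) - l) fun i i' h => by
            have : (i : ℤ) = (i' : ℤ) := by simpa using h
            exact Fin.ext (by exact_mod_cast this)
    _ = (∑' k, |a k|) * boundaryMass b n := by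
        simp only [tsum_mul_left]
        rw [← Finset.mul_sum, sum_tsum_outside b hb]

/-! ### Traces of powers -/

theorem trace_toeplitz (a : ℤ → ℝ) (n : ℕ) : (toeplitz a n).trace = n * a 0 := by
  simp [Matrix.trace, toeplitz]

theorem toeplitz_single (n : ℕ) : toeplitz (Pi.single 0 1) n = 1 := by
  ext i j
  simp only [toeplitz, Matrix.of_apply, Matrix.one_apply, Pi.single_apply, sub_eq_zero]
  norm_cast
  simp only [Fin.ext_iff]

/-- With `c` the `p`-fold power of `a`, the next error splits into `(B^p - T(c)) B`, `T(c) (B -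
T(a))` and `T(c) T(a) - T(c * a)`: the induction hypothesis with row bounds on `B`, the closeness
hypothesis with column bounds on `T(c)`, and the boundary estimate. -/
theorem tendsto_entrySum_pow_sub_toeplitz {κ : Type*} {l : Filter κ} {a : ℤ → ℝ}
    (ha : Summable fun k => |a k|) {n : κ → ℕ} (hn : Tendsto n l atTop)
    (B : ∀ k, Matrix (Fin (n k)) (Fin (n k)) ℝ)
    (hB : Tendsto (fun k => entrySum (B k - toeplitz a (n k)) / n k) l (𝓝 0))
    {K : ℝ} (hK : ∀ᶠ k in l, ∀ i, ∑ j, |B k i j| ≤ K) (p : ℕ) :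
    Tendsto (fun k => entrySum (B k ^ p - toeplitz (convPow a p) (n k)) / n k) l (𝓝 0) := by
  induction p with
  | zero =>
    have : ∀ k, B k ^ 0 - toeplitz (convPow a 0) (n k) = 0 := by
      intro k
      rw [pow_zero, convPow, toeplitz_single, sub_self]
    simp only [this, entrySum, Matrix.zero_apply, abs_zero, Finset.sum_const_zero, zero_div]
    exact tendsto_const_nhds
  | succ p ih =>
    have hc := summable_abs_convPow ha p
    set S := ∑' k, |convPow a p k|
    have hlim : Tendsto (fun k => entrySum (B k ^ p - toeplitz (convPow a p) (n k)) / n k * K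
        + S * (entrySum (B k - toeplitz a (n k)) / n k)
        + S * (boundaryMass a (n k) / n k)) l (𝓝 0) := by
      simpa using ((ih.mul_const K).add (hB.const_mul S)).add
        (((tendsto_boundaryMass_div ha).comp hn).const_mul S)
    refine squeeze_zero' (Eventually.of_forall fun k =>
      div_nonneg (entrySum_nonneg _) (Nat.cast_nonneg _)) ?_ hlim
    filter_upwards [hK] with k hk
    have e : B k ^ (p + 1) - toeplitz (convPow a (p + 1)) (n k)
        = (B k ^ p - toeplitz (convPow a p) (n k)) * B k
          + toeplitz (convPow a p) (n k) * (B k - toeplitz a (n k))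
          + (toeplitz (convPow a p) (n k) * toeplitz a (n k)
              - toeplitz (conv (convPow a p) a) (n k)) := by
      rw [pow_succ, convPow]
      noncomm_ring
    have h : entrySum (B k ^ (p + 1) - toeplitz (convPow a (p + 1)) (n k))
        ≤ entrySum (B k ^ p - toeplitz (convPow a p) (n k)) * K
          + S * entrySum (B k - toeplitz a (n k)) + S * boundaryMass a (n k) := by
      rw [e]
      refine (entrySum_add_le _ _).trans (add_le_add ((entrySum_add_le _ _).trans
        (add_le_add (entrySum_mul_le_of_row_le _ _ hk)
          (entrySum_mul_le_of_col_le _ _ fun j => toeplitz_col_le hc j)))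
        (entrySum_toeplitz_mul_sub hc ha _))
    calc _ ≤ _ := div_le_div_of_nonneg_right h (Nat.cast_nonneg _)
      _ = _ := by ring

/-- **Szegő's limit theorem for moments**: the normalized traces of the powers of a sequence of
matrices which is close to the Toeplitz matrices of `a` converge to the means of the powers of the
symbol. -/
theorem tendsto_trace_pow_div {κ : Type*} {l : Filter κ} {a : ℤ → ℝ}
    (ha : Summable fun k => |a k|) {n : κ → ℕ} (hn : Tendsto n l atTop)
    (B : ∀ k, Matrix (Fin (n k)) (Fin (n k)) ℝ)
    (hB : Tendsto (fun k => entrySum (B k - toeplitz a (n k)) / n k) l (𝓝 0))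
    {K : ℝ} (hK : ∀ᶠ k in l, ∀ i, ∑ j, |B k i j| ≤ K) (p : ℕ) :
    Tendsto (fun k => (B k ^ p).trace / n k) l (𝓝 (convPow a p 0)) := by
  rw [tendsto_iff_norm_sub_tendsto_zero]
  refine squeeze_zero' (Eventually.of_forall fun k => norm_nonneg _) ?_
    (tendsto_entrySum_pow_sub_toeplitz ha hn B hB hK p)
  filter_upwards [hn.eventually_gt_atTop 0] with k hk
  have hk' : (n k : ℝ) ≠ 0 := by positivity
  have e : (B k ^ p).trace / n k - convPow a p 0
      = (B k ^ p - toeplitz (convPow a p) (n k)).trace / n k := by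
    rw [Matrix.trace_sub, trace_toeplitz]
    field_simp
  rw [e, norm_div, Real.norm_eq_abs, Real.norm_natCast]
  exact div_le_div_of_nonneg_right (abs_trace_le_entrySum _) (Nat.cast_nonneg _)

/-! ### Convergence of moments -/

theorem integrable_of_continuous_of_abs_le {μ : Measure ℝ} [IsFiniteMeasure μ] {K : ℝ}
    (hK : ∀ᵐ x ∂μ, |x| ≤ K) {E : Type*} [NormedAddCommGroup E] [SecondCountableTopology E]
    [MeasurableSpace E] [BorelSpace E] {G : ℝ → E} (hG : Continuous G) : Integrable G μ := by
  obtain ⟨C, hC⟩ := (isCompact_Icc (a := -K) (b := K)).exists_bound_of_continuousOn hG.continuousOn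
  refine Integrable.of_bound hG.measurable.aestronglyMeasurable C ?_
  filter_upwards [hK] with x hx
  exact hC x (abs_le.1 hx)

theorem tendsto_integral_polynomial_sub {μ ν : ℕ → Measure ℝ} [∀ k, IsProbabilityMeasure (μ k)]
    [∀ k, IsProbabilityMeasure (ν k)] {K : ℝ} (hμ : ∀ᶠ k in atTop, ∀ᵐ x ∂μ k, |x| ≤ K)
    (hν : ∀ᶠ k in atTop, ∀ᵐ x ∂ν k, |x| ≤ K)
    (hmom : ∀ p : ℕ, Tendsto (fun k => ∫ x, x ^ p ∂μ k - ∫ x, x ^ p ∂ν k) atTop (𝓝 0))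
    (P : Polynomial ℝ) :
    Tendsto (fun k => ∫ x, P.eval x ∂μ k - ∫ x, P.eval x ∂ν k) atTop (𝓝 0) := by
  have h : Tendsto (fun k => ∑ i ∈ Finset.range (P.natDegree + 1),
      P.coeff i * (∫ x, x ^ i ∂μ k - ∫ x, x ^ i ∂ν k)) atTop (𝓝 0) := by
    simpa using tendsto_finsetSum (Finset.range (P.natDegree + 1))
      fun i _ => (hmom i).const_mul (P.coeff i)
  refine h.congr' ?_
  filter_upwards [hμ, hν] with k h1 h2
  have key : ∀ (ρ : Measure ℝ) [IsProbabilityMeasure ρ], (∀ᵐ x ∂ρ, |x| ≤ K) →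
      ∫ x, P.eval x ∂ρ = ∑ i ∈ Finset.range (P.natDegree + 1), P.coeff i * ∫ x, x ^ i ∂ρ := by
    intro ρ _ hρ
    simp only [Polynomial.eval_eq_sum_range]
    rw [integral_finsetSum _ fun i _ =>
      integrable_of_continuous_of_abs_le hρ (by fun_prop)]
    simp only [integral_const_mul]
  rw [key _ h1, key _ h2, ← Finset.sum_sub_distrib]
  simp only [mul_sub]

/-- Approximate `G` uniformly on `[-K, K]` by a polynomial; one third of `ε` goes to each of the two
replacements and one to the difference of polynomial integrals. -/
theorem tendsto_integral_sub_of_moments_real {μ ν : ℕ → Measure ℝ}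
    [∀ k, IsProbabilityMeasure (μ k)] [∀ k, IsProbabilityMeasure (ν k)] {K : ℝ}
    (hμ : ∀ᶠ k in atTop, ∀ᵐ x ∂μ k, |x| ≤ K) (hν : ∀ᶠ k in atTop, ∀ᵐ x ∂ν k, |x| ≤ K)
    (hmom : ∀ p : ℕ, Tendsto (fun k => ∫ x, x ^ p ∂μ k - ∫ x, x ^ p ∂ν k) atTop (𝓝 0))
    {G : ℝ → ℝ} (hG : Continuous G) :
    Tendsto (fun k => ∫ x, G x ∂μ k - ∫ x, G x ∂ν k) atTop (𝓝 0) := by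
  rw [Metric.tendsto_nhds]
  intro ε hε
  obtain ⟨P, hP⟩ := exists_polynomial_near_of_continuousOn (-K) K G hG.continuousOn (ε / 3)
    (by positivity)
  have hPt := (Metric.tendsto_nhds.1 (tendsto_integral_polynomial_sub hμ hν hmom P)) (ε / 3)
    (by positivity)
  filter_upwards [hμ, hν, hPt] with k h1 h2 h3
  have key : ∀ (ρ : Measure ℝ) [IsProbabilityMeasure ρ], (∀ᵐ x ∂ρ, |x| ≤ K) →
      |∫ x, P.eval x ∂ρ - ∫ x, G x ∂ρ| ≤ ε / 3 := by
    intro ρ _ hρ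
    rw [← integral_sub (integrable_of_continuous_of_abs_le hρ P.continuous)
      (integrable_of_continuous_of_abs_le hρ hG)]
    have hb := norm_integral_le_of_norm_le_const (μ := ρ)
      (f := fun x => P.eval x - G x) (C := ε / 3) (by
        filter_upwards [hρ] with x hx
        exact (hP x (abs_le.1 hx)).le)
    simpa using hb
  have k1 := abs_le.1 (key _ h1)
  have k2 := abs_le.1 (key _ h2)
  rw [Real.dist_eq, sub_zero, abs_lt] at h3 ⊢
  constructor <;> linarith [k1.1, k1.2, k2.1, k2.2, h3.1, h3.2]

/-- If the moments of two sequences of probability measures with uniformly bounded supports are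
asymptotically equal, then so are the integrals of every continuous function. -/
theorem tendsto_integral_sub_of_moments {μ ν : ℕ → Measure ℝ}
    [∀ k, IsProbabilityMeasure (μ k)] [∀ k, IsProbabilityMeasure (ν k)] {K : ℝ}
    (hμ : ∀ᶠ k in atTop, ∀ᵐ x ∂μ k, |x| ≤ K) (hν : ∀ᶠ k in atTop, ∀ᵐ x ∂ν k, |x| ≤ K)
    (hmom : ∀ p : ℕ, Tendsto (fun k => ∫ x, x ^ p ∂μ k - ∫ x, x ^ p ∂ν k) atTop (𝓝 0))
    {G : ℝ → ℂ} (hG : Continuous G) :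
    Tendsto (fun k => ∫ x, G x ∂μ k - ∫ x, G x ∂ν k) atTop (𝓝 0) := by
  have hre := tendsto_integral_sub_of_moments_real hμ hν hmom (Complex.continuous_re.comp hG)
  have him := tendsto_integral_sub_of_moments_real hμ hν hmom (Complex.continuous_im.comp hG)
  have h := ((Complex.continuous_ofReal.tendsto 0).comp hre).add
    (((Complex.continuous_ofReal.tendsto 0).comp him).mul_const Complex.I)
  rw [Complex.ofReal_zero, zero_mul, add_zero] at h
  refine h.congr' ?_
  filter_upwards [hμ, hν] with k h1 h2
  rw [← integral_re_add_im (integrable_of_continuous_of_abs_le h1 hG),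
    ← integral_re_add_im (integrable_of_continuous_of_abs_le h2 hG)]
  simp only [Function.comp_apply, RCLike.re_to_complex, RCLike.im_to_complex, RCLike.I_to_complex,
    Complex.coe_algebraMap]
  push_cast
  ring

/-! ### Eigenvalues of symmetric matrices -/

section Eigenvalues

variable {ι : Type} [Fintype ι] [DecidableEq ι] {A : Matrix ι ι ℝ}

theorem eigMean_map_ofReal (hA : A.IsHermitian) (F : ℂ → ℂ) :
    eigMean (A.map (fun a : ℝ => (a : ℂ))) F
      = (∑ i, F (hA.eigenvalues i : ℂ)) / (Fintype.card ι : ℂ) := by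
  have h : (A.map (fun a : ℝ => (a : ℂ))).charpoly.roots
      = Finset.univ.val.map fun i => (hA.eigenvalues i : ℂ) := by
    change (A.map Complex.ofRealHom).charpoly.roots = _
    rw [Matrix.charpoly_map, hA.charpoly_eq, Polynomial.map_prod]
    simp only [Polynomial.map_sub, Polynomial.map_X, Polynomial.map_C]
    rw [← Polynomial.roots_multiset_prod_X_sub_C
      (Finset.univ.val.map fun i => (hA.eigenvalues i : ℂ)), Multiset.map_map]
    rfl
  rw [eigMean, h, Multiset.map_map]
  rfl

theorem trace_pow_eq_sum_eigenvalues_pow (hA : A.IsHermitian) (p : ℕ) :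
    (A ^ p).trace = ∑ i, hA.eigenvalues i ^ p := by
  conv_lhs => rw [hA.spectral_theorem]
  rw [← map_pow, Unitary.conjStarAlgAut_apply, Matrix.trace_mul_cycle, Unitary.coe_star_mul_self,
    one_mul, Matrix.diagonal_pow, Matrix.trace_diagonal]
  rfl

/-- Gershgorin: an eigenvalue lies within the off-diagonal row sum of some diagonal entry. -/
theorem abs_eigenvalues_le (hA : A.IsHermitian) {K : ℝ} (hK : ∀ i, ∑ j, |A i j| ≤ K) (i : ι) :
    |hA.eigenvalues i| ≤ K := by
  have h := hA.eigenvalues_mem_spectrum_real i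
  rw [← Matrix.spectrum_toLin', ← Module.End.hasEigenvalue_iff_mem_spectrum] at h
  obtain ⟨k, hk⟩ := eigenvalue_mem_ball h
  rw [Metric.mem_closedBall, Real.dist_eq] at hk
  refine le_trans ?_ (hK k)
  rw [← Finset.add_sum_erase _ _ (Finset.mem_univ k)]
  have h2 := abs_add_le (hA.eigenvalues i - A k k) (A k k)
  rw [sub_add_cancel] at h2
  simp only [Real.norm_eq_abs] at hk
  linarith

/-- The uniform probability measure on the eigenvalues of a symmetric matrix. -/
noncomputable def empiricalMeasure (hA : A.IsHermitian) : Measure ℝ :=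
  (Fintype.card ι : ENNReal)⁻¹ • ∑ i, Measure.dirac (hA.eigenvalues i)

instance [Nonempty ι] (hA : A.IsHermitian) : IsProbabilityMeasure (empiricalMeasure hA) := by
  constructor
  rw [empiricalMeasure]
  simp only [Measure.smul_apply, Measure.finsetSum_apply, measure_univ, Finset.sum_const,
    Finset.card_univ, nsmul_eq_mul, mul_one, smul_eq_mul]
  exact ENNReal.inv_mul_cancel (by simp) (by simp)

theorem integral_empiricalMeasure (hA : A.IsHermitian) {E : Type*} [NormedAddCommGroup E]
    [NormedSpace ℝ E] [CompleteSpace E] [SecondCountableTopology E] [MeasurableSpace E]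
    [BorelSpace E] {G : ℝ → E} :
    ∫ x, G x ∂empiricalMeasure hA
      = (Fintype.card ι : ℝ)⁻¹ • ∑ i, G (hA.eigenvalues i) := by
  rw [empiricalMeasure, integral_smul_measure, integral_finsetSum_measure
    fun i _ => integrable_dirac (by simp)]
  simp only [integral_dirac, ENNReal.toReal_inv, ENNReal.toReal_natCast]

theorem empiricalMeasure_abs_le (hA : A.IsHermitian) {K : ℝ} (hK : ∀ i, ∑ j, |A i j| ≤ K) :
    ∀ᵐ x ∂empiricalMeasure hA, |x| ≤ K := by
  rw [empiricalMeasure]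
  refine Measure.ae_smul_measure ?_ _
  rw [ae_iff, Measure.finsetSum_apply]
  refine Finset.sum_eq_zero fun i _ => ?_
  rw [← ae_iff]
  rw [ae_dirac_eq]
  exact abs_eigenvalues_le hA hK i

end Eigenvalues

/-- The mean of a test function over a real symbol as an integral over the image measure. -/
theorem symbolMean_eq_integral_map {X : Type} [MeasureSpace X] {φ : X → ℝ} (hφ : Measurable φ)
    (G : Set X) {F : ℂ → ℂ} (hF : Continuous F) :
    symbolMean (fun x => (φ x : ℂ)) G F
      = ∫ x : ℝ, F x ∂(Measure.map φ (ProbabilityTheory.cond volume G)) := by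
  rw [integral_map (f := fun x : ℝ => F x) hφ.aemeasurable
    (hF.comp Complex.continuous_ofReal).measurable.aestronglyMeasurable, ProbabilityTheory.cond,
    integral_smul_measure, symbolMean, ENNReal.toReal_inv, Complex.real_smul]
  push_cast
  rfl

/-- Moment criterion for the eigenvalue distribution of a sequence of symmetric matrices. -/
theorem eigDistributedVarying_of_moments {n : ℕ → Type} [∀ k, Fintype (n k)]
    [∀ k, DecidableEq (n k)] [∀ k, Nonempty (n k)] {A : ∀ k, Matrix (n k) (n k) ℝ}
    (hA : ∀ k, (A k).IsHermitian) {X : Type} [MeasureSpace X] {φ : ℕ → X → ℝ}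
    (hφ : ∀ k, Measurable (φ k)) {G : Set X} (hG0 : volume G ≠ 0) (hG : volume G ≠ ⊤) {K : ℝ}
    (hAK : ∀ᶠ k in atTop, ∀ i, ∑ j, |A k i j| ≤ K) (hφK : ∀ᶠ k in atTop, ∀ x, |φ k x| ≤ K)
    (hmom : ∀ p : ℕ, Tendsto (fun k => (((A k ^ p).trace / Fintype.card (n k) : ℝ) : ℂ)
      - symbolMean (fun x => (φ k x : ℂ)) G (fun z => z ^ p)) atTop (𝓝 0)) :
    EigDistributedVarying (fun k => (A k).map (fun a : ℝ => (a : ℂ)))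
      (fun k x => (φ k x : ℂ)) G := by
  intro F hF _
  have := ProbabilityTheory.cond_isProbabilityMeasure_of_finite hG0 hG
  have hprob : ∀ k, IsProbabilityMeasure
      (Measure.map (φ k) (ProbabilityTheory.cond volume G)) :=
    fun k => Measure.isProbabilityMeasure_map (hφ k).aemeasurable
  have h := tendsto_integral_sub_of_moments (μ := fun k => empiricalMeasure (hA k))
    (ν := fun k => Measure.map (φ k) (ProbabilityTheory.cond volume G)) (K := K)
    (hAK.mono fun k hk => empiricalMeasure_abs_le (hA k) hk)
    (hφK.mono fun k hk => by
      rw [ae_map_iff (hφ k).aemeasurable (measurableSet_le (by fun_prop) measurable_const)]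
      exact Eventually.of_forall hk)
    (fun p => ?_) (hF.comp Complex.continuous_ofReal)
  · refine h.congr fun k => ?_
    rw [symbolMean_eq_integral_map (hφ k) G hF, eigMean_map_ofReal (hA k)]
    simp only [Function.comp_apply]
    rw [integral_empiricalMeasure, Complex.real_smul]
    push_cast
    rw [div_eq_inv_mul]
  · have h2 := (Complex.continuous_re.tendsto 0).comp (hmom p)
    rw [Complex.zero_re] at h2
    refine h2.congr fun k => ?_
    simp only [Function.comp_apply]
    rw [symbolMean_eq_integral_map (hφ k) G (continuous_pow p), Complex.sub_re, Complex.ofReal_re]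
    have e : ∫ x : ℝ, (x : ℂ) ^ p ∂(Measure.map (φ k) (ProbabilityTheory.cond volume G))
        = ((∫ x : ℝ, x ^ p ∂(Measure.map (φ k) (ProbabilityTheory.cond volume G)) : ℝ) : ℂ) := by
      rw [← integral_complex_ofReal]
      push_cast
      rfl
    rw [e, Complex.ofReal_re, integral_empiricalMeasure, smul_eq_mul,
      trace_pow_eq_sum_eigenvalues_pow (hA k), div_eq_inv_mul]

/-! ### Kronecker sums -/

section KroneckerSum

variable {ι κ : Type} [Fintype ι] [DecidableEq ι] [Fintype κ] [DecidableEq κ]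

theorem one_kronecker_pow (B : Matrix κ κ ℝ) (p : ℕ) :
    ((1 : Matrix ι ι ℝ) ⊗ₖ B) ^ p = (1 : Matrix ι ι ℝ) ⊗ₖ (B ^ p) := by
  induction p with
  | zero => simp
  | succ p ih => rw [pow_succ, ih, ← Matrix.mul_kronecker_mul, one_mul, ← pow_succ]

theorem kronecker_one_pow (C : Matrix ι ι ℝ) (p : ℕ) :
    (C ⊗ₖ (1 : Matrix κ κ ℝ)) ^ p = (C ^ p) ⊗ₖ (1 : Matrix κ κ ℝ) := by
  induction p with
  | zero => simp
  | succ p ih => rw [pow_succ, ih, ← Matrix.mul_kronecker_mul, one_mul, ← pow_succ]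

/-- The summands act on different tensor factors and commute, so the binomial theorem applies and
each trace factors. -/
theorem trace_kroneckerSum_pow (B : Matrix κ κ ℝ) (C : Matrix ι ι ℝ) (d x : ℝ) (p : ℕ) :
    ((d • ((1 : Matrix ι ι ℝ) ⊗ₖ B) + x • (C ⊗ₖ (1 : Matrix κ κ ℝ))) ^ p).trace
      = ∑ m ∈ Finset.range (p + 1),
          d ^ m * x ^ (p - m) * p.choose m * ((B ^ m).trace * (C ^ (p - m)).trace) := by
  have hc : Commute (d • ((1 : Matrix ι ι ℝ) ⊗ₖ B)) (x • (C ⊗ₖ (1 : Matrix κ κ ℝ))) := by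
    refine Commute.smul_left (Commute.smul_right ?_ x) d
    rw [commute_iff_eq, ← Matrix.mul_kronecker_mul, ← Matrix.mul_kronecker_mul]
    simp
  rw [hc.add_pow, Matrix.trace_sum]
  refine Finset.sum_congr rfl fun m _ => ?_
  rw [smul_pow, smul_pow, one_kronecker_pow, kronecker_one_pow, smul_mul_smul_comm,
    ← Matrix.mul_kronecker_mul, one_mul, mul_one, ← nsmul_eq_mul', Matrix.trace_smul,
    Matrix.trace_smul, Matrix.trace_kronecker, nsmul_eq_mul, smul_eq_mul]
  ring

theorem kroneckerSum_row_le {B : Matrix κ κ ℝ} {C : Matrix ι ι ℝ} (d x : ℝ) {K L : ℝ}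
    (hB : ∀ i, ∑ j, |B i j| ≤ K) (hC : ∀ i, ∑ j, |C i j| ≤ L) (i : ι × κ) :
    ∑ j, |(d • ((1 : Matrix ι ι ℝ) ⊗ₖ B) + x • (C ⊗ₖ (1 : Matrix κ κ ℝ))) i j|
      ≤ |d| * K + |x| * L := by
  have one_row : ∀ {η : Type} [Fintype η] [DecidableEq η] (i : η),
      ∑ j, |(1 : Matrix η η ℝ) i j| = 1 := by
    intro η _ _ i
    rw [Finset.sum_eq_single i]
    · simp
    · intro j _ hj
      simp [Matrix.one_apply_ne hj.symm]
    · simp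
  calc _ ≤ ∑ j : ι × κ, (|d| * (|(1 : Matrix ι ι ℝ) i.1 j.1| * |B i.2 j.2|)
        + |x| * (|C i.1 j.1| * |(1 : Matrix κ κ ℝ) i.2 j.2|)) := by
        refine Finset.sum_le_sum fun j _ => ?_
        simp only [Matrix.add_apply, Matrix.smul_apply, Matrix.kroneckerMap_apply, smul_eq_mul]
        refine (abs_add_le _ _).trans (le_of_eq ?_)
        simp only [abs_mul]
    _ = |d| * ∑ j, |B i.2 j| + |x| * ∑ j, |C i.1 j| := by
        rw [Finset.sum_add_distrib, ← Finset.mul_sum, ← Finset.mul_sum,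
          Fintype.sum_prod_type, Fintype.sum_prod_type]
        dsimp only
        simp only [← Finset.mul_sum, one_row, mul_one]
        rw [Finset.sum_comm]
        simp only [← Finset.sum_mul, one_row, one_mul]
    _ ≤ _ := by
        gcongr
        · exact hB i.2
        · exact hC i.1

end KroneckerSum

theorem volume_real_square :
    (volume : Measure (ℝ × ℝ)).real (Icc (-Real.pi) Real.pi ×ˢ Icc (-Real.pi) Real.pi)
      = (2 * Real.pi) * (2 * Real.pi) := by
  rw [Measure.volume_eq_prod, Measure.real, Measure.prod_prod, ENNReal.toReal_mul,
    Real.volume_Icc, ENNReal.toReal_ofReal (by linarith [Real.pi_pos])]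
  ring

/-- Fubini gives the same binomial expansion as for the trace, so moments can be compared term by
term. -/
theorem symbolMean_pow_kroneckerSum {f g : ℝ → ℂ} (hf : Continuous f) (hg : Continuous g)
    (d x : ℂ) (p : ℕ) :
    symbolMean (fun θ : ℝ × ℝ => d * f θ.1 + x * g θ.2)
        (Icc (-Real.pi) Real.pi ×ˢ Icc (-Real.pi) Real.pi) (fun z => z ^ p)
      = ∑ m ∈ Finset.range (p + 1), d ^ m * x ^ (p - m) * p.choose m
          * (circleMean (fun ξ => f ξ ^ m) * circleMean (fun ξ => g ξ ^ (p - m))) := by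
  rw [symbolMean, volume_real_square]
  simp only [add_pow, mul_pow]
  rw [integral_finsetSum, Finset.mul_sum]
  · refine Finset.sum_congr rfl fun m _ => ?_
    have e : ∀ θ : ℝ × ℝ, d ^ m * f θ.1 ^ m * (x ^ (p - m) * g θ.2 ^ (p - m)) * (p.choose m : ℂ)
        = (d ^ m * x ^ (p - m) * p.choose m) * (f θ.1 ^ m * g θ.2 ^ (p - m)) := fun θ => by ring
    simp only [e]
    rw [integral_const_mul, Measure.volume_eq_prod,
      setIntegral_prod_mul (fun ξ => f ξ ^ m) (fun ξ => g ξ ^ (p - m)), circleMean, circleMean]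
    push_cast
    rw [mul_inv]
    ring
  · intro m _
    refine ContinuousOn.integrableOn_compact (isCompact_Icc.prod isCompact_Icc) ?_
    exact (by fun_prop : Continuous _).continuousOn

/-! ### Eigenvalue distribution of Kronecker sums of Toeplitz matrices -/

/-- A bounded factor which vanishes in the limit along bounded `n k` compensates for the error
`δ (n k)`, which vanishes in the limit only for unbounded `n k`. -/
theorem tendsto_mul_comp_of_eq_mul {x u : ℕ → ℝ} {v δ : ℕ → ℝ} {n : ℕ → ℕ}
    (hx : x =O[atTop] fun _ => (1 : ℝ)) (hu : Tendsto u atTop (𝓝 0))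
    (hxu : ∀ k, x k = u k * v (n k)) (hδ : Tendsto δ atTop (𝓝 0)) :
    Tendsto (fun k => x k * δ (n k)) atTop (𝓝 0) := by
  obtain ⟨C, hC0, hC⟩ := hx.exists_pos
  rw [isBigOWith_iff] at hC
  rw [Metric.tendsto_nhds]
  intro ε hε
  obtain ⟨N, hN⟩ := eventually_atTop.1 ((Metric.tendsto_nhds.1 hδ) (ε / C) (by positivity))
  -- `S` bounds `|v j * δ j|` for all small sizes `j < N` at once, where `δ` need not be small and
  -- `u` has to supply the decay; `S + 1` avoids dividing by zero. For sizes at least `N`,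
  -- boundedness of `x` suffices.
  set S := ∑ j ∈ Finset.range N, |v j * δ j|
  have hS : 0 ≤ S := Finset.sum_nonneg fun _ _ => abs_nonneg _
  have hu' := (Metric.tendsto_nhds.1 hu) (ε / (S + 1)) (by positivity)
  filter_upwards [hC, hu'] with k h1 h2
  rw [Real.dist_eq, sub_zero] at h2 ⊢
  rcases lt_or_ge (n k) N with h | h
  · rw [hxu, mul_assoc, abs_mul]
    have h3 : |v (n k) * δ (n k)| ≤ S :=
      Finset.single_le_sum (f := fun j => |v j * δ j|) (fun _ _ => abs_nonneg _)
        (Finset.mem_range.2 h)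
    calc |u k| * |v (n k) * δ (n k)| ≤ |u k| * (S + 1) := by gcongr; linarith
      _ < ε / (S + 1) * (S + 1) := by gcongr
      _ = ε := by field_simp
  · have h3 := hN _ h
    rw [Real.dist_eq, sub_zero] at h3
    rw [norm_one, mul_one, Real.norm_eq_abs] at h1
    rw [abs_mul]
    calc |x k| * |δ (n k)| ≤ C * |δ (n k)| := by gcongr
      _ < C * (ε / C) := by gcongr
      _ = ε := by field_simp

theorem toeplitz_isHermitian {a : ℤ → ℝ} (ha : ∀ k, a (-k) = a k) (n : ℕ) :
    (toeplitz a n).IsHermitian := by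
  ext i j
  simp only [Matrix.conjTranspose_apply, toeplitz, Matrix.of_apply, star_trivial]
  rw [← ha, neg_sub]

theorem entrySum_smul_one (t : ℝ) (n : ℕ) :
    entrySum (t • (1 : Matrix (Fin n) (Fin n) ℝ)) = n * |t| := by
  simp [entrySum, Matrix.one_apply, apply_ite abs]

theorem shifted_toeplitz_row_le {a : ℤ → ℝ} (ha : Summable fun k => |a k|) {t : ℝ}
    (ht : |t| ≤ 1) {n : ℕ} (i : Fin n) :
    ∑ j, |(t • (1 : Matrix (Fin n) (Fin n) ℝ) + toeplitz a n) i j| ≤ 1 + ∑' k, |a k| := by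
  have h1 : ∑ j, |(t • (1 : Matrix (Fin n) (Fin n) ℝ)) i j| = |t| := by
    simp [Matrix.one_apply, apply_ite abs]
  calc _ ≤ ∑ j, |(t • (1 : Matrix (Fin n) (Fin n) ℝ)) i j| + ∑ j, |toeplitz a n i j| := by
        rw [← Finset.sum_add_distrib]
        exact Finset.sum_le_sum fun j _ => abs_add_le _ _
    _ ≤ _ := add_le_add (h1.le.trans ht) (toeplitz_row_le ha i)

theorem tendsto_trace_pow_shifted_toeplitz {a : ℤ → ℝ} (ha : Summable fun k => |a k|)
    {n : ℕ → ℕ} (hn : Tendsto n atTop atTop) {t : ℕ → ℝ} (ht : Tendsto t atTop (𝓝 0)) (p : ℕ) :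
    Tendsto (fun k => ((t k • (1 : Matrix (Fin (n k)) (Fin (n k)) ℝ)
      + toeplitz a (n k)) ^ p).trace / n k) atTop (𝓝 (convPow a p 0)) := by
  refine tendsto_trace_pow_div ha hn _ ?_ (K := 1 + ∑' k, |a k|) ?_ p
  · simp only [add_sub_cancel_right, entrySum_smul_one]
    refine squeeze_zero (fun k => by positivity) (fun k => ?_) (by simpa using ht.abs)
    exact div_le_of_le_mul₀ (Nat.cast_nonneg _) (abs_nonneg _) (mul_comm _ _).le
  · have : ∀ᶠ k in atTop, |t k| ≤ 1 := by
      have h := ht.abs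
      rw [abs_zero] at h
      exact h.eventually_le_const one_pos
    exact this.mono fun k hk => shifted_toeplitz_row_le ha hk

theorem tendsto_trace_pow_toeplitz {a : ℤ → ℝ} (ha : Summable fun k => |a k|) (p : ℕ) :
    Tendsto (fun n : ℕ => (toeplitz a n ^ p).trace / n) atTop (𝓝 (convPow a p 0)) := by
  have h := tendsto_trace_pow_shifted_toeplitz ha tendsto_id
    (tendsto_const_nhds (x := (0 : ℝ))) p
  simpa using h

theorem tendsto_pow_mul_trace_error {b : ℤ → ℝ} (hb : Summable fun k => |b k|) {n : ℕ → ℕ}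
    (hn : ∀ k, 0 < n k) {x u : ℕ → ℝ} {v : ℕ → ℝ} (hx : x =O[atTop] fun _ => (1 : ℝ))
    (hu : Tendsto u atTop (𝓝 0)) (hxu : ∀ k, x k = u k * v (n k)) (i : ℕ) :
    Tendsto (fun k => x k ^ i * ((toeplitz b (n k) ^ i).trace / n k - convPow b i 0))
      atTop (𝓝 0) := by
  rcases i with _ | i
  -- The zeroth power supplies no factor `x`, but its error vanishes identically because the size is
  -- positive.
  · refine tendsto_const_nhds.congr fun k => ?_
    have : (n k : ℝ) ≠ 0 := by exact_mod_cast (hn k).ne'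
    simp [convPow, this]
  · have hδ : Tendsto (fun n : ℕ => (toeplitz b n ^ (i + 1)).trace / n - convPow b (i + 1) 0)
        atTop (𝓝 0) := by
      simpa using (tendsto_trace_pow_toeplitz hb (i + 1)).sub_const (convPow b (i + 1) 0)
    -- A single factor `x` absorbs the trace error; the other `i` factors only need to stay bounded.
    have h1 := tendsto_mul_comp_of_eq_mul hx hu hxu hδ
    have h2 : (fun k => x k ^ i) =O[atTop] fun _ => (1 : ℝ) := by
      simpa using hx.pow i
    have h3 := h2.mul_isLittleO ((isLittleO_one_iff ℝ).2 h1)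
    simp only [mul_one] at h3
    refine ((isLittleO_one_iff ℝ).1 h3).congr fun k => ?_
    ring

theorem tendsto_trace_kroneckerSum_sub {a b : ℤ → ℝ} (ha : Summable fun k => |a k|)
    (hb : Summable fun k => |b k|) {n₁ n₂ : ℕ → ℕ} (hn₂ : ∀ k, 0 < n₂ k)
    (hn₁ : Tendsto n₁ atTop atTop) (d : ℝ) {t x u v : ℕ → ℝ} (ht : Tendsto t atTop (𝓝 0))
    (hx : x =O[atTop] fun _ => (1 : ℝ)) (hu : Tendsto u atTop (𝓝 0))
    (hxu : ∀ k, x k = u k * v (n₂ k)) (p : ℕ) :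
    Tendsto (fun k =>
      ((d • ((1 : Matrix (Fin (n₂ k)) (Fin (n₂ k)) ℝ) ⊗ₖ
          (t k • (1 : Matrix (Fin (n₁ k)) (Fin (n₁ k)) ℝ) + toeplitz a (n₁ k)))
        + x k • (toeplitz b (n₂ k) ⊗ₖ (1 : Matrix (Fin (n₁ k)) (Fin (n₁ k)) ℝ))) ^ p).trace
          / (n₂ k * n₁ k)
      - ∑ m ∈ Finset.range (p + 1), d ^ m * x k ^ (p - m) * p.choose m
          * (convPow a m 0 * convPow b (p - m) 0)) atTop (𝓝 0) := by
  -- The difference of products is split so that the `T(b)` error, which may persist for bounded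
  -- `n₂`, keeps the factor `x^(p-m)`. The `T(a)` error tends to zero by itself.
  have hterm : ∀ m, Tendsto (fun k => d ^ m * p.choose m *
      (x k ^ (p - m) * ((toeplitz b (n₂ k) ^ (p - m)).trace / n₂ k - convPow b (p - m) 0)
          * (((t k • (1 : Matrix (Fin (n₁ k)) (Fin (n₁ k)) ℝ) + toeplitz a (n₁ k)) ^ m).trace
              / n₁ k)
        + x k ^ (p - m) * convPow b (p - m) 0
          * (((t k • (1 : Matrix (Fin (n₁ k)) (Fin (n₁ k)) ℝ) + toeplitz a (n₁ k)) ^ m).trace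
              / n₁ k - convPow a m 0))) atTop (𝓝 0) := by
    intro m
    have h1 := tendsto_trace_pow_shifted_toeplitz ha hn₁ ht m
    have h2 := tendsto_pow_mul_trace_error hb hn₂ hx hu hxu (p - m)
    have h3 : Tendsto (fun k =>
        ((t k • (1 : Matrix (Fin (n₁ k)) (Fin (n₁ k)) ℝ) + toeplitz a (n₁ k)) ^ m).trace
              / n₁ k - convPow a m 0) atTop (𝓝 0) := by
      simpa using h1.sub_const (convPow a m 0)
    have h4 : (fun k => x k ^ (p - m) * convPow b (p - m) 0) =O[atTop] fun _ => (1 : ℝ) := by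
      simpa using (hx.pow (p - m)).mul
        (isBigO_const_const (convPow b (p - m) 0) (one_ne_zero (α := ℝ)) atTop)
    have h5 := h4.mul_isLittleO ((isLittleO_one_iff ℝ).2 h3)
    simp only [mul_one] at h5
    simpa using ((h2.mul h1).add ((isLittleO_one_iff ℝ).1 h5)).const_mul (d ^ m * p.choose m : ℝ)
  have hsum := tendsto_finsetSum (Finset.range (p + 1)) fun m _ => hterm m
  rw [Finset.sum_const_zero] at hsum
  refine hsum.congr fun k => ?_
  rw [trace_kroneckerSum_pow, Finset.sum_div, ← Finset.sum_sub_distrib]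
  refine Finset.sum_congr rfl fun m _ => ?_
  rw [mul_div_assoc, mul_comm (n₂ k : ℝ), mul_div_mul_comm]
  ring

/-- **Szegő's theorem for Kronecker sums** of symmetric Toeplitz matrices with a factor `x k`
depending on the size. -/
theorem eigDistributedVarying_kroneckerSum {a b : ℤ → ℝ} (ha : Summable fun k => |a k|)
    (hb : Summable fun k => |b k|) (ha' : ∀ k, a (-k) = a k) (hb' : ∀ k, b (-k) = b k)
    {n₁ n₂ : ℕ → ℕ} (hn₁' : ∀ k, 0 < n₁ k) (hn₂ : ∀ k, 0 < n₂ k)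
    (hn₁ : Tendsto n₁ atTop atTop) (d : ℝ) {t x u v : ℕ → ℝ} (ht : Tendsto t atTop (𝓝 0))
    (hx : x =O[atTop] fun _ => (1 : ℝ)) (hu : Tendsto u atTop (𝓝 0))
    (hxu : ∀ k, x k = u k * v (n₂ k)) {φ : ℕ → ℝ × ℝ → ℝ}
    (hφ : ∀ k θ, (φ k θ : ℂ) = d * trigSum a θ.1 + x k * trigSum b θ.2) :
    EigDistributedVarying
      (fun k => (d • ((1 : Matrix (Fin (n₂ k)) (Fin (n₂ k)) ℝ) ⊗ₖ
          (t k • (1 : Matrix (Fin (n₁ k)) (Fin (n₁ k)) ℝ) + toeplitz a (n₁ k)))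
        + x k • (toeplitz b (n₂ k) ⊗ₖ (1 : Matrix (Fin (n₁ k)) (Fin (n₁ k)) ℝ))).map
          (fun z : ℝ => (z : ℂ)))
      (fun k θ => (φ k θ : ℂ)) (Icc (-Real.pi) Real.pi ×ˢ Icc (-Real.pi) Real.pi) := by
  have : ∀ k, Nonempty (Fin (n₂ k) × Fin (n₁ k)) := fun k => ⟨(⟨0, hn₂ k⟩, ⟨0, hn₁' k⟩)⟩
  obtain ⟨C, hC0, hC⟩ := hx.exists_pos
  rw [isBigOWith_iff] at hC
  simp only [norm_one, mul_one, Real.norm_eq_abs] at hC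
  have hSb : 0 ≤ ∑' k, |b k| := tsum_nonneg fun _ => abs_nonneg _
  have hvol := volume_real_square
  have hvol0 : (volume : Measure (ℝ × ℝ)).real
      (Icc (-Real.pi) Real.pi ×ˢ Icc (-Real.pi) Real.pi) ≠ 0 := by
    rw [hvol]; positivity
  rw [Measure.real, ENNReal.toReal_ne_zero] at hvol0
  refine eigDistributedVarying_of_moments (fun k => ?_) (fun k => ?_) hvol0.1 hvol0.2
    (K := |d| * (1 + ∑' k, |a k|) + C * ∑' k, |b k|) ?_ ?_ fun p => ?_
  · have h1 := toeplitz_isHermitian ha' (n₁ k)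
    have h2 := toeplitz_isHermitian hb' (n₂ k)
    rw [Matrix.IsHermitian] at h1 h2 ⊢
    simp only [Matrix.conjTranspose_add, Matrix.conjTranspose_smul, star_trivial,
      Matrix.conjTranspose_kronecker, Matrix.conjTranspose_one, h1, h2]
  · have : φ k = fun θ => ((d : ℂ) * trigSum a θ.1 + x k * trigSum b θ.2).re := by
      funext θ
      rw [← hφ, Complex.ofReal_re]
    rw [this]
    have h1 := continuous_trigSum ha
    have h2 := continuous_trigSum hb
    exact (by fun_prop : Continuous _).measurable
  · have ht1 : ∀ᶠ k in atTop, |t k| ≤ 1 := by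
      have h := ht.abs
      rw [abs_zero] at h
      exact h.eventually_le_const one_pos
    filter_upwards [ht1, hC] with k h1 h2 i
    refine (kroneckerSum_row_le d (x k) (shifted_toeplitz_row_le ha h1)
      (toeplitz_row_le hb) i).trans ?_
    gcongr
  · filter_upwards [hC] with k h1 θ
    have h : ‖(φ k θ : ℂ)‖ ≤ |d| * (1 + ∑' k, |a k|) + C * ∑' k, |b k| := by
      rw [hφ]
      refine (norm_add_le _ _).trans ?_
      rw [norm_mul, norm_mul, Complex.norm_real, Complex.norm_real, Real.norm_eq_abs,
        Real.norm_eq_abs]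
      gcongr
      · linarith [norm_trigSum_le ha θ.1]
      · exact norm_trigSum_le hb θ.2
    rwa [Complex.norm_real, Real.norm_eq_abs] at h
  · have h := (Complex.continuous_ofReal.tendsto 0).comp
      (tendsto_trace_kroneckerSum_sub ha hb hn₂ hn₁ d ht hx hu hxu p)
    rw [Complex.ofReal_zero] at h
    refine h.congr fun k => ?_
    simp only [Function.comp_apply, hφ]
    rw [symbolMean_pow_kroneckerSum (continuous_trigSum ha) (continuous_trigSum hb)]
    simp only [circleMean_trigSum_pow ha, circleMean_trigSum_pow hb, Fintype.card_prod,
      Fintype.card_fin]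
    push_cast
    rfl

/-- Compact support makes `F` bounded, which provides a constant majorant on the set of finite
measure. -/
theorem tendsto_symbolMean {X : Type} [TopologicalSpace X] [MeasureSpace X]
    [OpensMeasurableSpace X] {f : ℕ → X → ℂ} {g : X → ℂ} (hf : ∀ k, Continuous (f k)) {G : Set X}
    (hG : volume G ≠ ⊤) (hfg : ∀ x, Tendsto (fun k => f k x) atTop (𝓝 (g x))) {F : ℂ → ℂ}
    (hF : Continuous F) (hFc : HasCompactSupport F) :
    Tendsto (fun k => symbolMean (f k) G F) atTop (𝓝 (symbolMean g G F)) := by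
  obtain ⟨C, hC⟩ := hF.bounded_above_of_compact_support hFc
  have : IsFiniteMeasure ((volume : Measure X).restrict G) :=
    ⟨by rw [Measure.restrict_apply_univ]; exact hG.lt_top⟩
  refine Tendsto.const_mul _ ?_
  refine tendsto_integral_of_dominated_convergence (fun _ => C)
    (fun k => (hF.comp (hf k)).measurable.aestronglyMeasurable)
    (integrable_const C) (fun k => Eventually.of_forall fun x => hC _)
    (Eventually.of_forall fun x => (hF.tendsto _).comp (hfg x))

/-! ### The coefficient matrices -/

namespace FDEData

variable (P : FDEData)

theorem hx_pos (n : ℕ) : 0 < P.hx n := div_pos (sub_pos.2 P.hab₁) (by positivity)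

theorem hy_pos (n : ℕ) : 0 < P.hy n := div_pos (sub_pos.2 P.hab₂) (by positivity)

theorem dt_pos {M : ℕ} (hM : 0 < M) : 0 < P.dt M := div_pos P.hT (by exact_mod_cast hM)

/-- The time step cancels, leaving a function of `n₁` times a function of `n₂`, as
`tendsto_mul_comp_of_eq_mul` requires. -/
theorem s_div_r (n₁ n₂ : ℕ) {M : ℕ} (hM : 0 < M) :
    P.s n₂ M / P.r n₁ M = P.hx n₁ ^ P.α * (P.hy n₂ ^ P.β)⁻¹ := by
  have h1 := (P.dt_pos hM).ne'
  have h2 := (Real.rpow_pos_of_pos (P.hx_pos n₁) P.α).ne'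
  have h3 := (Real.rpow_pos_of_pos (P.hy_pos n₂) P.β).ne'
  rw [s, r]
  field_simp

theorem grid_mem_Ioo {a b : ℝ} (hab : a < b) {n : ℕ} (i : Fin n) :
    a + (((i : ℕ) : ℝ) + 1) * ((b - a) / ((n : ℝ) + 1)) ∈ Ioo a b := by
  have hn : (0 : ℝ) < (n : ℝ) + 1 := by positivity
  have hb : 0 < b - a := sub_pos.2 hab
  have hi : ((i : ℕ) : ℝ) + 1 < (n : ℝ) + 1 := by
    have : ((i : ℕ) : ℝ) < n := by exact_mod_cast i.2
    linarith
  constructor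
  · have : 0 < (((i : ℕ) : ℝ) + 1) * ((b - a) / ((n : ℝ) + 1)) := by positivity
    linarith
  · have h : (((i : ℕ) : ℝ) + 1) * ((b - a) / ((n : ℝ) + 1)) < b - a := by
      rw [← mul_div_assoc, div_lt_iff₀ hn, mul_comm]
      exact mul_lt_mul_of_pos_left hi hb
    linarith

theorem time_mem_Ioc {M m : ℕ} (hm : 1 ≤ m ∧ m ≤ M) : (m : ℝ) * P.dt M ∈ Ioc 0 P.T := by
  have hM : 0 < M := lt_of_lt_of_le hm.1 hm.2
  have hM' : (0 : ℝ) < M := by exact_mod_cast hM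
  have hm' : (0 : ℝ) < m := by exact_mod_cast hm.1
  refine ⟨mul_pos hm' (P.dt_pos hM), ?_⟩
  rw [dt, ← mul_div_assoc, div_le_iff₀ hM', mul_comm]
  exact mul_le_mul_of_nonneg_left (by exact_mod_cast hm.2) P.hT.le

theorem diagSample_eq_smul_one {c : ℝ → ℝ → ℝ → ℝ} {e : ℝ}
    (hc : ∀ x ∈ Ioo P.a₁ P.b₁, ∀ y ∈ Ioo P.a₂ P.b₂, ∀ t ∈ Ioc 0 P.T, c x y t = e)
    (n₁ n₂ : ℕ) {M m : ℕ} (hm : 1 ≤ m ∧ m ≤ M) : P.diagSample c n₁ n₂ M m = e • 1 := by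
  rw [← Matrix.diagonal_one, ← Matrix.diagonal_smul, diagSample]
  congr 1
  funext p
  exact (hc _ (grid_mem_Ioo P.hab₁ p.2) _ (grid_mem_Ioo P.hab₂ p.1) _ (P.time_mem_Ioc hm)).trans
    (mul_one e).symm

/-- The identity term is absorbed into the `x` factor, where it is a scalar shift of the Toeplitz
matrix; the factor `d⁻¹` offsets the outer `d`. -/
theorem coeffMatrix_eq_kroneckerSum {d e : ℝ} (hd : 0 < d)
    (hcoeff : ∀ x ∈ Ioo P.a₁ P.b₁, ∀ y ∈ Ioo P.a₂ P.b₂, ∀ t ∈ Ioc 0 P.T,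
      P.dPlus x y t = d ∧ P.dMinus x y t = d ∧ P.ePlus x y t = e ∧ P.eMinus x y t = e)
    (n₁ n₂ : ℕ) {M m : ℕ} (hm : 1 ≤ m ∧ m ≤ M) :
    P.coeffMatrix n₁ n₂ M m
      = d • ((1 : Matrix (Fin n₂) (Fin n₂) ℝ) ⊗ₖ
          ((1 / P.r n₁ M * d⁻¹) • (1 : Matrix (Fin n₁) (Fin n₁) ℝ) + toeplitz (symCoeff P.α) n₁))
        + (e * (P.s n₂ M / P.r n₁ M)) •
            (toeplitz (symCoeff P.β) n₂ ⊗ₖ (1 : Matrix (Fin n₁) (Fin n₁) ℝ)) := by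
  rw [coeffMatrix, matAx, matAy,
    P.diagSample_eq_smul_one (fun x hx y hy t ht => (hcoeff x hx y hy t ht).1) n₁ n₂ hm,
    P.diagSample_eq_smul_one (fun x hx y hy t ht => (hcoeff x hx y hy t ht).2.1) n₁ n₂ hm,
    P.diagSample_eq_smul_one (fun x hx y hy t ht => (hcoeff x hx y hy t ht).2.2.1) n₁ n₂ hm,
    P.diagSample_eq_smul_one (fun x hx y hy t ht => (hcoeff x hx y hy t ht).2.2.2) n₁ n₂ hm,
    ← toepA_add_transpose, ← toepA_add_transpose, Matrix.kronecker_add, Matrix.kronecker_add,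
    Matrix.add_kronecker, Matrix.kronecker_smul, Matrix.one_kronecker_one]
  simp only [Matrix.smul_mul, one_mul, smul_add, smul_smul]
  rw [mul_comm d (1 / P.r n₁ M * d⁻¹), mul_assoc (1 / P.r n₁ M), inv_mul_cancel₀ hd.ne', mul_one,
    mul_comm e]

/-- Since `1/r = 2 M h_x^α / T` and `M ≥ 1`, the quantity `h_x^α` is at most `(T/2)(1/r)`. -/
theorem tendsto_hx_rpow {n₁ M : ℕ → ℕ} (hM : ∀ k, 0 < M k)
    (hr : Tendsto (fun k => 1 / P.r (n₁ k) (M k)) atTop (𝓝 0)) :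
    Tendsto (fun k => P.hx (n₁ k) ^ P.α) atTop (𝓝 0) := by
  have h := hr.const_mul (P.T / 2)
  rw [mul_zero] at h
  refine squeeze_zero (fun k => (Real.rpow_pos_of_pos (P.hx_pos _) _).le) (fun k => ?_) h
  have h1 := Real.rpow_pos_of_pos (P.hx_pos (n₁ k)) P.α
  have hM1 : (1 : ℝ) ≤ M k := by exact_mod_cast hM k
  have hT := P.hT
  have e : P.T / 2 * (1 / P.r (n₁ k) (M k)) = P.hx (n₁ k) ^ P.α * M k := by
    rw [r, dt]
    field_simp
  rw [e]
  exact le_mul_of_one_le_right h1.le hM1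

theorem tendsto_atTop_of_hx_rpow {n₁ : ℕ → ℕ}
    (h : Tendsto (fun k => P.hx (n₁ k) ^ P.α) atTop (𝓝 0)) : Tendsto n₁ atTop atTop := by
  have hα : 0 < P.α := by linarith [P.hα.1]
  rw [tendsto_atTop]
  intro N
  have hpos := Real.rpow_pos_of_pos (P.hx_pos N) P.α
  filter_upwards [h.eventually_lt_const hpos] with k hk
  rw [Real.rpow_lt_rpow_iff (P.hx_pos _).le (P.hx_pos _).le hα] at hk
  by_contra hc
  push Not at hc
  refine absurd hk (not_lt.2 ?_)
  have hb : 0 ≤ P.b₁ - P.a₁ := (sub_pos.2 P.hab₁).le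
  have : (n₁ k : ℝ) ≤ N := by exact_mod_cast hc.le
  rw [hx, hx]
  gcongr

end FDEData

/-! ### The two-dimensional symbol and the distribution theorem -/

theorem continuous_symbolF {α β : ℝ} (hα : α ∈ Ioo (1 : ℝ) 2) (hβ : β ∈ Ioo (1 : ℝ) 2)
    (d e c : ℝ) : Continuous (symbolF α β d e c) := by
  have h1 := continuous_qSymbol hα
  have h2 := continuous_qSymbol hβ
  unfold symbolF
  fun_prop

theorem symbolF_im (α β d e c : ℝ) (θ : ℝ × ℝ) : (symbolF α β d e c θ).im = 0 := by
  simp [symbolF, qSymbol_im]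

theorem symbolF_re_nonneg {α β : ℝ} (hα : α ∈ Ioo (1 : ℝ) 2) (hβ : β ∈ Ioo (1 : ℝ) 2)
    {d e c : ℝ} (hd : 0 ≤ d) (he : 0 ≤ e) (hc : 0 ≤ c) (θ : ℝ × ℝ) :
    0 ≤ (symbolF α β d e c θ).re := by
  have h1 := qSymbol_re_nonneg hα θ.1
  have h2 := qSymbol_re_nonneg hβ θ.2
  have : (symbolF α β d e c θ).re = d * (qSymbol α θ.1).re + e * c * (qSymbol β θ.2).re := by
    simp [symbolF, qSymbol_im]
  rw [this]
  positivity

theorem proposition3 (P : FDEData) (d e : ℝ) (hd : 0 < d) (he : 0 < e)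
    (hcoeff : ∀ x ∈ Ioo P.a₁ P.b₁, ∀ y ∈ Ioo P.a₂ P.b₂, ∀ t ∈ Ioc 0 P.T,
      P.dPlus x y t = d ∧ P.dMinus x y t = d ∧ P.ePlus x y t = e ∧ P.eMinus x y t = e)
    (n₁ n₂ M m : ℕ → ℕ)
    (hn₁ : ∀ k, 0 < n₁ k) (hn₂ : ∀ k, 0 < n₂ k) (hm : ∀ k, 1 ≤ m k ∧ m k ≤ M k)
    (hN : Tendsto (fun k => n₁ k * n₂ k) atTop atTop)
    (hr : (fun k => 1 / P.r (n₁ k) (M k)) =o[atTop] (fun _ => (1 : ℝ)))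
    (hsr : (fun k => P.s (n₂ k) (M k) / P.r (n₁ k) (M k)) =O[atTop] (fun _ => (1 : ℝ))) :
    -- the series defining the symbols converge absolutely, and `f_γ(-ξ)` is conjugate to `f_γ(ξ)`
    (Summable (fun k => |wCoeff P.α k|) ∧ Summable (fun k => |wCoeff P.β k|)) ∧
    (∀ ξ : ℝ, fSymbol P.α (-ξ) = (starRingEnd ℂ) (fSymbol P.α ξ) ∧
      fSymbol P.β (-ξ) = (starRingEnd ℂ) (fSymbol P.β ξ)) ∧
    -- the symbol is continuous, real-valued and nonnegative, for every value `c ≥ 0` of the ratio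
    (∀ c : ℝ, 0 ≤ c → Continuous (symbolF P.α P.β d e c) ∧
      ∀ θ : ℝ × ℝ, (symbolF P.α P.β d e c θ).im = 0 ∧ 0 ≤ (symbolF P.α P.β d e c θ).re) ∧
    -- eigenvalue distribution with the ratio `s / r` of each discretization in the symbol
    EigDistributedVarying
      (fun k => (P.coeffMatrix (n₁ k) (n₂ k) (M k) (m k)).map (fun a : ℝ => (a : ℂ)))
      (fun k => symbolF P.α P.β d e (P.s (n₂ k) (M k) / P.r (n₁ k) (M k)))
      (Icc (-Real.pi) Real.pi ×ˢ Icc (-Real.pi) Real.pi) ∧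
    -- eigenvalue distribution with a fixed symbol whenever `s / r` has a limit
    (∀ c : ℝ, Tendsto (fun k => P.s (n₂ k) (M k) / P.r (n₁ k) (M k)) atTop (𝓝 c) →
      EigDistributed
        (fun k => (P.coeffMatrix (n₁ k) (n₂ k) (M k) (m k)).map (fun a : ℝ => (a : ℂ)))
        (symbolF P.α P.β d e c)
        (Icc (-Real.pi) Real.pi ×ˢ Icc (-Real.pi) Real.pi)) := by

  have hM : ∀ k, 0 < M k := fun k => lt_of_lt_of_le (hm k).1 (hm k).2
  have hr' := (isLittleO_one_iff ℝ).1 hr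
  have hhx := P.tendsto_hx_rpow hM hr'
  have hdist : EigDistributedVarying
      (fun k => (P.coeffMatrix (n₁ k) (n₂ k) (M k) (m k)).map (fun a : ℝ => (a : ℂ)))
      (fun k => symbolF P.α P.β d e (P.s (n₂ k) (M k) / P.r (n₁ k) (M k)))
      (Icc (-Real.pi) Real.pi ×ˢ Icc (-Real.pi) Real.pi) := by
    -- The moment criterion takes real symbols, so the symbol is replaced by its real part and
    -- restored afterwards.
    have hre : ∀ c θ, ((symbolF P.α P.β d e c θ).re : ℂ) = symbolF P.α P.β d e c θ :=
      fun c θ => Complex.ext (Complex.ofReal_re _)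
        ((Complex.ofReal_im _).trans (symbolF_im _ _ _ _ _ _).symm)
    have h := eigDistributedVarying_kroneckerSum (summable_symCoeff P.hα)
      (summable_symCoeff P.hβ) (symCoeff_neg P.α) (symCoeff_neg P.β) hn₁ hn₂
      (P.tendsto_atTop_of_hx_rpow hhx) d
      (t := fun k => 1 / P.r (n₁ k) (M k) * d⁻¹)
      (x := fun k => e * (P.s (n₂ k) (M k) / P.r (n₁ k) (M k)))
      (u := fun k => P.hx (n₁ k) ^ P.α) (v := fun n => e * (P.hy n ^ P.β)⁻¹)
      (by simpa using hr'.mul_const d⁻¹) (hsr.const_mul_left e) hhx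
      (fun k => by rw [P.s_div_r _ _ (hM k)]; ring)
      (φ := fun k θ => (symbolF P.α P.β d e (P.s (n₂ k) (M k) / P.r (n₁ k) (M k)) θ).re)
      (fun k θ => by
        rw [hre, symbolF, qSymbol_eq_trigSum P.hα, qSymbol_eq_trigSum P.hβ]
        push_cast
        rfl)
    simp only [hre] at h
    have e1 : ∀ k, P.coeffMatrix (n₁ k) (n₂ k) (M k) (m k) = _ := fun k =>
      P.coeffMatrix_eq_kroneckerSum hd hcoeff (n₁ k) (n₂ k) (hm k)
    simp only [e1]
    exact h
  refine ⟨⟨summable_abs_wCoeff P.hα, summable_abs_wCoeff P.hβ⟩,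
    fun ξ => ⟨fSymbol_neg _ _, fSymbol_neg _ _⟩,
    fun c hc => ⟨continuous_symbolF P.hα P.hβ d e c, fun θ => ⟨symbolF_im _ _ _ _ _ _,
      symbolF_re_nonneg P.hα P.hβ hd.le he.le hc θ⟩⟩, hdist, fun c hc F hF hFc => ?_⟩
  have hvol : (volume : Measure (ℝ × ℝ)) (Icc (-Real.pi) Real.pi ×ˢ Icc (-Real.pi) Real.pi) ≠ ⊤ :=
    (isCompact_Icc.prod isCompact_Icc).measure_lt_top.ne
  have h2 := tendsto_symbolMean
    (f := fun k => symbolF P.α P.β d e (P.s (n₂ k) (M k) / P.r (n₁ k) (M k)))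
    (g := symbolF P.α P.β d e c) (fun k => continuous_symbolF P.hα P.hβ d e _) hvol
    (fun θ => by
      have hc' := (Complex.continuous_ofReal.tendsto c).comp hc
      exact ((hc'.const_mul (e : ℂ)).mul_const _).const_add _) hF hFc
  -- For convergent `s/r` the varying means converge to the mean of the limit symbol; adding this to
  -- the varying statement cancels the varying means.
  simpa using (hdist F hF hFc).add h2
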